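/- **Setting.** Let $\beta_\Theta>0$, $\Theta=[-\beta_\Theta,\beta_\Theta]$, and let $\theta^*\in\Theta$ be the true parameter, with $\theta^*>0$. Let $d$ be a distance function on $\mathbb R$ that is strictly increasing along the line (if $x<y<z$ then $d(x,y)<d(x,z)$ and $d(y,z)<d(x,z)$), and let $u(\theta)=-d(\theta,\theta^*)$. For $\theta\in\Theta$ let $c^-_\Delta(\theta)<\theta<c^+_\Delta(\theta)$ be points with $d(c^\pm_\Delta(\theta),\theta)=\Delta/2$, where $\Delta>0$. Asked to compare them, a human (with noise level $\gamma>0$) selects $c_\Delta^-(\theta)$ with probability $p^-_\gamma(\theta)=\big[1+\exp\{(u(c_\Delta^+(\theta))-u(c_\Delta^-(\theta)))/\gamma\}\big]^{-1}$ and $c_\Delta^+(\theta)$ with probability $p^+_\gamma(\theta)=1-p^-_\gamma(\theta)$. Let $\tilde p(\theta)=p_\gamma^+(\theta)$ if $\theta\le\theta^*$ and $\tilde p(\theta)=p_\gamma^-(\theta)$ if $\theta>\theta^*$ be the probability that one comparison identifies the direction of $\theta^*$ correctly. **Algorithm.** Fix $\eta\in(0,1)$ and $p\in(1/2,1-\eta/2)$.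 Start from a prior density $\rho_0$ on $\Theta$ that is positive everywhere on $\Theta$, with distribution $\mu_0$. At stage $k=0,1,2,\dots$ the query point $\theta_k$ is the median of $\rho_k$. Independent comparisons $Z_{k,1},Z_{k,2},\dots$ are collected at $\theta_k$, where $Z_{k,i}=+1$ if $c_\Delta^+(\theta_k)$ is selected (probability $p^+_\gamma(\theta_k)$ given the past) and $Z_{k,i}=-1$ otherwise, up to the power-one stopping time $\tau_1^\uparrow(\theta_k)=\inf\{m\ge1: |S_{k,m}|\ge (2m(\ln(m+1)-\ln\eta))^{1/2}\}$, where $S_{k,m}=\sum_{i\le m}Z_{k,i}$. If the walk stops at a positive value, then $\rho_{k+1}=2p\,\rho_k$ on $[\theta_k,\infty)$ and $\rho_{k+1}=2(1-p)\rho_k$ on $(-\infty,\theta_k)$; if it stops at a negative value, the factors $2p$ and $2(1-p)$ are exchanged; if it never stops, $\rho_{k+1}=\rho_k$. The algorithm may stop earlier, according to arbitrary thresholds $k_{\rm loc},k_{\rm end},s_{\max}\in\mathbb N\cup\{\infty\}$: it stops after $k_{\rm end}$ stages, and at a stage $k\ge k_{\rm loc}$ it terminates as soon as $s_{\max}$ comparisons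 have been collected at $\theta_k$; the first stage is always begun and each stage that is begun collects at least one comparison. The sequence $(\theta_k)_{k\ge0}$ is continued by the above recursion irrespective of early stopping. Let $T^\uparrow(\theta_k)$ be the number of comparisons that the algorithm collects at stage $k$ ($0$ if stage $k$ is not reached; no stage is reached after a test that never stops). **Phase I.** For $a\in(0,\theta^*+\beta_\Theta)$ let $T(a)$ and $T'(a)$ be the first times from which on $(\theta_k)$ never reenters $[-\beta_\Theta,\theta^*-a]$ and $[\theta^*+a,\beta_\Theta]$, respectively ($\infty$ if there is no such time), and let $\psi(a)=\max\{T(a),T'(a)\}$. For $c_1,c_2>0$ let $\phi(\tilde p)=c_1|2\tilde p-1|^{-2}\ln(|2\tilde p-1|^{-1})+c_2$. **Proposition (Sample complexity of Phase I).** There are positive constants $c_1,c_2$ (depending only on $\eta$), $r_1,r_2,\alpha,\beta_2,r_R$ (depending only on $\eta$ and $p$), and $\beta_1$ (depending only on $\eta$, $p$ and $\theta^*$) such that the following holds for all $\beta_\Theta,\rho_0,d,\Delta,\gamma,c_\Delta^\pm,k_{\rm loc},k_{\rm end},s_{\max}$ as above, all $a\in(0,\theta^*+\beta_\Theta)$ and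 all $\varsigma\le1$. If $\mu_0((\theta^*-a,\theta^*])\ge a^\varsigma$ and, in case $\theta^*+a\le\beta_\Theta$, also $\mu_0([\theta^*,\theta^*+a))\ge a^\varsigma$, then \[ \mathbb E\left[\sum_{0\le k\le\psi(a)} T^{\uparrow}(\theta_k)\,\mathbf 1(|\theta_k-\theta^*|\ge a)\right]\le\left(\frac{4\theta^*}{r_2\alpha a^{\varsigma}}+\frac{4\beta_1}{r_1}+\frac{2\beta_2}{r_R}\right)\ \sup_{\theta\in\Theta,\ |\theta-\theta^*|\ge a}\phi(\tilde p(\theta)), \] where the supremum, taken in $[0,\infty]$, is the maximum whenever the latter exists. -/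

import Mathlib

open MeasureTheory ProbabilityTheory

noncomputable section

namespace MAPB

/-! ### The human comparison model on the line -/

/-- A distance function on the line which is strictly increasing along the line: when `z` moves
away from `x` in a fixed direction, its distance to `x` increases.  Equivalently, for every possible
true parameter the utility `u = -d(·, θ*)` is strictly unimodal with its peak at `θ*`.
(Positivity of `d x y` for `x ≠ y` follows.) -/
structure IsLineDistance (d : ℝ → ℝ → ℝ) : Prop where
  self : ∀ x, d x x = 0
  symm : ∀ x y, d x y = d y x
  triangle : ∀ x y z, d x z ≤ d x y + d y z
  lt_left : ∀ x y z, x < y → y < z → d x y < d x z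
  lt_right : ∀ x y z, x < y → y < z → d y z < d x z

/-- `cm θ` and `cp θ` are the two points offered to the human at the query point `θ`: they lie on
opposite sides of `θ`, both at distance `Δ / 2` from it. -/
def IsComparisonPair (d : ℝ → ℝ → ℝ) (bΘ Δ : ℝ) (cm cp : ℝ → ℝ) : Prop :=
  ∀ θ ∈ Set.Icc (-bΘ) bΘ,
    cm θ < θ ∧ θ < cp θ ∧ d (cm θ) θ = Δ / 2 ∧ d (cp θ) θ = Δ / 2

/-- The utility of the parameter `θ` when the true parameter is `θs`. -/
def utility (d : ℝ → ℝ → ℝ) (θs θ : ℝ) : ℝ := -d θ θs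

/-- Probability that the human selects the left point `cm θ`
(random utility model with Gumbel noise of parameter `γ`). -/
def pMinus (d : ℝ → ℝ → ℝ) (θs γ : ℝ) (cm cp : ℝ → ℝ) (θ : ℝ) : ℝ :=
  (1 + Real.exp ((utility d θs (cp θ) - utility d θs (cm θ)) / γ))⁻¹

/-- Probability that the human selects the right point `cp θ`. -/
def pPlus (d : ℝ → ℝ → ℝ) (θs γ : ℝ) (cm cp : ℝ → ℝ) (θ : ℝ) : ℝ :=
  1 - pMinus d θs γ cm cp θ

/-- Probability that one comparison at `θ` correctly identifies the direction of `θs`. -/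
def pTilde (d : ℝ → ℝ → ℝ) (θs γ : ℝ) (cm cp : ℝ → ℝ) (θ : ℝ) : ℝ :=
  if θ ≤ θs then pPlus d θs γ cm cp θ else pMinus d θs γ cm cp θ

/-- The bound on the expected number of vertical moves, as a function of the accuracy `x`. -/
def phi (c₁ c₂ x : ℝ) : ℝ :=
  c₁ * (|2 * x - 1| ^ 2)⁻¹ * Real.log (|2 * x - 1|⁻¹) + c₂

/-! ### Vertical moves: the power-one test -/

/-- The outcome of one comparison, driven by a number `u` which is uniform on `[0, 1]`:
`+1` (right point selected) with probability `x`, and `-1` (left point selected) otherwise. -/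
def response (u x : ℝ) : ℤ := if u < x then 1 else -1

/-- The random walk `S_m`, the sum of the first `m` outcomes. -/
def walk (z : ℕ → ℤ) (m : ℕ) : ℤ := ∑ i ∈ Finset.range m, z i

/-- The boundary `(2 m (ln (m + 1) - ln η)) ^ (1 / 2)` of the test. -/
def boundary (η : ℝ) (m : ℕ) : ℝ :=
  Real.sqrt (2 * (m : ℝ) * (Real.log ((m : ℝ) + 1) - Real.log η))

/-- The stopping time of the power-one test: the first `m ≥ 1` with `|S_m|` at or beyond the
boundary, and `⊤` if there is none. -/
def testTime (η : ℝ) (z : ℕ → ℤ) : ℕ∞ :=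
  ⨅ (m : ℕ) (_ : 1 ≤ m ∧ boundary η m ≤ |(walk z m : ℝ)|), (m : ℕ∞)

/-- The decision of the test: the sign of the walk when the test stops, and `0` (no decision) if
the test never stops. -/
def decision (η : ℝ) (z : ℕ → ℤ) : ℤ :=
  if testTime η z = ⊤ then 0 else Int.sign (walk z (testTime η z).toNat)

/-! ### Horizontal moves: the posterior densities and their medians -/

/-- The measure with density `ρ`. -/
def densityMeasure (ρ : ℝ → ℝ) : Measure ℝ :=
  volume.withDensity fun t => ENNReal.ofReal (ρ t)

/-- A probability density on `[-bΘ, bΘ]` which is positive everywhere on that interval. -/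
structure IsPriorDensity (bΘ : ℝ) (ρ : ℝ → ℝ) : Prop where
  measurable : Measurable ρ
  pos : ∀ t ∈ Set.Icc (-bΘ) bΘ, 0 < ρ t
  eq_zero : ∀ t, t ∉ Set.Icc (-bΘ) bΘ → ρ t = 0
  mass_one : densityMeasure ρ Set.univ = 1

/-- The median of the distribution with density `ρ`. -/
def median (ρ : ℝ → ℝ) : ℝ := sInf {x | 1 / 2 ≤ densityMeasure ρ (Set.Iic x)}

/-- The update of the density `ρ` after the decision `s` of the test at the point `x`.
If the test made no decision, the density is kept. -/
def update (p : ℝ) (ρ : ℝ → ℝ) (x : ℝ) (s : ℤ) : ℝ → ℝ := fun t =>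
  if s = 1 then (if x ≤ t then 2 * p * ρ t else 2 * (1 - p) * ρ t)
  else if s = -1 then (if x ≤ t then 2 * (1 - p) * ρ t else 2 * p * ρ t)
  else ρ t

/-- The density `ρ_k` after `k` horizontal moves.  Here `pr θ` is the probability that the human
selects the right point at the query point `θ`, and `u k i` is the uniform number that drives the
`i`-th comparison of the `k`-th test. -/
def posterior (p η : ℝ) (pr : ℝ → ℝ) (ρ₀ : ℝ → ℝ) (u : ℕ → ℕ → ℝ) : ℕ → ℝ → ℝ
  | 0 => ρ₀
  | k + 1 =>
    update p (posterior p η pr ρ₀ u k) (median (posterior p η pr ρ₀ u k))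
      (decision η fun i => response (u k i) (pr (median (posterior p η pr ρ₀ u k))))

/-- The `k`-th query point `θ_k`, the median of `ρ_k`. -/
def query (p η : ℝ) (pr : ℝ → ℝ) (ρ₀ : ℝ → ℝ) (u : ℕ → ℕ → ℝ) (k : ℕ) : ℝ :=
  median (posterior p η pr ρ₀ u k)

/-- The length of the `k`-th power-one test, the one performed at `θ_k`. -/
def testLength (p η : ℝ) (pr : ℝ → ℝ) (ρ₀ : ℝ → ℝ) (u : ℕ → ℕ → ℝ) (k : ℕ) : ℕ∞ :=
  testTime η fun i => response (u k i) (pr (query p η pr ρ₀ u k))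

/-- The algorithm performs the stage `k`: `kEnd` is the number of horizontal moves after which it
stops, and it terminates during a stage `j ≥ kLoc` if the test of that stage reaches the vertical
threshold `sMax`; no stage follows a test that never stops. -/
def Reached (p η : ℝ) (pr : ℝ → ℝ) (ρ₀ : ℝ → ℝ) (kLoc kEnd sMax : ℕ∞) (u : ℕ → ℕ → ℝ)
    (k : ℕ) : Prop :=
  (k = 0 ∨ (k : ℕ∞) < kEnd) ∧ ∀ j < k, testLength p η pr ρ₀ u j ≠ ⊤ ∧
    ¬ (kLoc ≤ (j : ℕ∞) ∧ sMax ≤ testLength p η pr ρ₀ u j)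

open Classical in
/-- The number of comparisons which the algorithm collects at its `k`-th query point. -/
def comparisons (p η : ℝ) (pr : ℝ → ℝ) (ρ₀ : ℝ → ℝ) (kLoc kEnd sMax : ℕ∞) (u : ℕ → ℕ → ℝ)
    (k : ℕ) : ℕ∞ :=
  if Reached p η pr ρ₀ kLoc kEnd sMax u k then
    (if kLoc ≤ (k : ℕ∞) then min (testLength p η pr ρ₀ u k) (max 1 sMax)
      else testLength p η pr ρ₀ u k)
  else 0

/-! ### Phase I -/

/-- The first time from which on the sequence `x` never again enters `A` (`⊤` if there is none). -/
def neverReenterTime (x : ℕ → ℝ) (A : Set ℝ) : ℕ∞ :=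
  ⨅ (k' : ℕ) (_ : ∀ k, k' ≤ k → x k ∉ A), (k' : ℕ∞)

/-- The length of Phase I: `psi = max {T(a), T'(a)}`, where `T(a)` and `T'(a)` are the times from
which on the medians never reenter `[-bΘ, θs - a]` and `[θs + a, bΘ]`. -/
def psi (bΘ θs a : ℝ) (x : ℕ → ℝ) : ℕ∞ :=
  max (neverReenterTime x (Set.Icc (-bΘ) (θs - a))) (neverReenterTime x (Set.Icc (θs + a) bΘ))

open Classical in
/-- The number of comparisons collected during Phase I at query points whose distance from `θs` is
at least `a`. -/
def phaseOneComparisons (p η : ℝ) (pr : ℝ → ℝ) (ρ₀ : ℝ → ℝ) (kLoc kEnd sMax : ℕ∞)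
    (bΘ θs a : ℝ) (u : ℕ → ℕ → ℝ) : ENNReal :=
  ∑' k : ℕ,
    if (k : ℕ∞) ≤ psi bΘ θs a (query p η pr ρ₀ u) ∧ a ≤ |query p η pr ρ₀ u k - θs| then
      ((comparisons p η pr ρ₀ kLoc kEnd sMax u k : ℕ∞) : ENNReal)
    else 0

end MAPB

end

/-! Early stopping only removes comparisons, so it suffices to bound, for the algorithm that never
stops early, the expected number of comparisons made at query points in `Iic (θs - a)` and in `Ici
(θs + a)`. The two sides are symmetric and are treated together.

Fix the far region `A` on one side of `θs` and the near region `N` between `A` and `θs`. The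
potential is the square root of the odds `mass A / mass N`. If the median lies on the other side of
`θs`, or at `θs`, then up to a null set `A` and `N` lie on the same side of it, and the odds do not
change, whatever the test decides. If the median lies between `A` and `θs`, the odds do not increase
on average (`odds_mid_le`), because the test errs with probability at most `η / 2 < 1 - p`. If the
median lies in `A`, the odds shrink on average by a factor `1 - oddsDrift` (`odds_far_le`), hence by
Jensen their root shrinks by the factor `1 - sqrtDrift`. In that case `A` carries at least half of
the mass, so the root is at least `1` and drops by at least `sqrtDrift` (`sqrt_odds_drift`). A
Lyapunov argument (`lintegral_tsum_le_of_drift`) bounds the expected number of visits to `A` by the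
initial root over `sqrtDrift`, that is by a multiple of `a ^ (-ς / 2)`. Each visit costs at most the
supremum of `phi` in expectation.

The root is essential: the odds themselves would give a multiple of `a ^ (-ς)` whose factor is not
proportional to `θs`. From the root, the inequality of arithmetic and geometric means produces the
term `θs / a ^ ς` at the price of a constant of order `1 / θs`.

Two facts about the power-one test enter. Its expected length is at most `phi`, since the walk has
drift `2 * x - 1` and the boundary grows only like `√(m log m)` (`lintegral_testTime_le_phi`). Its
error probability is at most `η / 2`: a mixture martingale of the fair walk starts at `1` and is at
least `1 / η` on the boundary, symmetry halves the bound, and a bias in the right direction only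
helps (`hitProb_neg_le`). -/

namespace MAPB

/-! ### Sequences of independent variables and their shift -/

/-- Prepend an element to a sequence. -/
def seqCons {E : Type*} (w : E × (ℕ → E)) : ℕ → E
  | 0 => w.1
  | n + 1 => w.2 n

@[simp] lemma seqCons_zero {E : Type*} (w : E × (ℕ → E)) : seqCons w 0 = w.1 := rfl

@[simp] lemma seqCons_succ {E : Type*} (w : E × (ℕ → E)) (n : ℕ) :
    seqCons w (n + 1) = w.2 n := rfl

lemma measurable_seqCons {E : Type*} [MeasurableSpace E] :
    Measurable (seqCons : E × (ℕ → E) → ℕ → E) := by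
  refine measurable_pi_iff.2 fun n => ?_
  cases n with
  | zero => exact measurable_fst
  | succ n => exact (measurable_pi_apply n).comp measurable_snd

/-- An i.i.d. sequence is its first entry followed by an independent copy of itself. This gives
first-step analysis both for the walk inside one test and for the chain of densities. -/
lemma map_seqCons_infinitePi {E : Type*} [MeasurableSpace E] (ν : Measure E)
    [IsProbabilityMeasure ν] :
    (ν.prod (Measure.infinitePi fun _ : ℕ => ν)).map seqCons =
      Measure.infinitePi fun _ : ℕ => ν := by
  refine Measure.eq_infinitePi _ fun s t ht => ?_
  classical
  rw [Measure.map_apply measurable_seqCons (.pi s.countable_toSet fun i _ => ht i)]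
  have key : seqCons ⁻¹' (Set.pi s t) =
      (if 0 ∈ s then t 0 else Set.univ) ×ˢ
        Set.pi (s.preimage Nat.succ Nat.succ_injective.injOn : Finset ℕ)
          (fun i => t (i + 1)) := by
    ext w
    simp only [Set.mem_preimage, Set.mem_pi, Set.mem_prod, Finset.mem_coe, Finset.mem_preimage]
    constructor
    · intro h
      refine ⟨?_, fun i hi => h (i + 1) hi⟩
      split_ifs with h0
      · exact h 0 h0
      · trivial
    · rintro ⟨h0, h1⟩ i hi
      cases i with
      | zero => simpa [hi] using h0
      | succ i => exact h1 i hi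
  rw [key, Measure.prod_prod, Measure.infinitePi_pi _ fun i _ => ht (i + 1)]
  have himg : (s.preimage Nat.succ Nat.succ_injective.injOn).image Nat.succ = s.erase 0 := by
    ext i
    cases i <;> simp
  have hprod : ∏ i ∈ s.preimage Nat.succ Nat.succ_injective.injOn, ν (t (i + 1)) =
      ∏ i ∈ s.erase 0, ν (t i) := by
    rw [← himg, Finset.prod_image Nat.succ_injective.injOn]
  rw [hprod]
  split_ifs with h0
  · exact Finset.mul_prod_erase s (fun i => ν (t i)) h0
  · rw [measure_univ, one_mul, Finset.erase_eq_of_notMem h0]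

lemma lintegral_infinitePi_succ {E : Type*} [MeasurableSpace E] (ν : Measure E)
    [IsProbabilityMeasure ν] {F : (ℕ → E) → ENNReal} (hF : Measurable F) :
    ∫⁻ u, F u ∂(Measure.infinitePi fun _ : ℕ => ν) =
      ∫⁻ v, ∫⁻ u, F (seqCons (v, u)) ∂(Measure.infinitePi fun _ : ℕ => ν) ∂ν := by
  conv_lhs => rw [← map_seqCons_infinitePi ν]
  rw [lintegral_map hF measurable_seqCons,
    lintegral_prod (fun w => F (seqCons w)) (hF.comp measurable_seqCons).aemeasurable]

/-! ### The law of the responses -/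

/-- The uniform distribution on `[0, 1]`. -/
noncomputable def unif : Measure ℝ := volume.restrict (Set.Icc (0 : ℝ) 1)

instance : IsProbabilityMeasure unif := ⟨by simp [unif]⟩

/-- The law of a response which is `1` with probability `x`. -/
noncomputable def coin (x : ℝ) : Measure ℤ := unif.map fun u => response u x

/-- The law of independent responses which are `1` with probability `x`. -/
noncomputable def coins (x : ℝ) : Measure (ℕ → ℤ) := Measure.infinitePi fun _ => coin x

lemma measurable_response (x : ℝ) : Measurable fun u => response u x :=
  Measurable.ite (measurableSet_lt measurable_id measurable_const) measurable_const
    measurable_const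

instance (x : ℝ) : IsProbabilityMeasure (coin x) :=
  Measure.isProbabilityMeasure_map (measurable_response x).aemeasurable

instance (x : ℝ) : IsProbabilityMeasure (coins x) := by unfold coins; infer_instance

lemma map_response_infinitePi (x : ℝ) :
    (Measure.infinitePi fun _ : ℕ => unif).map (fun u i => response (u i) x) = coins x := by
  rw [Measure.infinitePi_map_pi (f := fun _ u => response u x) _ fun _ => measurable_response x]
  rfl

lemma lintegral_coin {x : ℝ} (hx : x ∈ Set.Icc (0 : ℝ) 1) (F : ℤ → ENNReal) :
    ∫⁻ z, F z ∂coin x = ENNReal.ofReal x * F 1 + ENNReal.ofReal (1 - x) * F (-1) := by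
  rw [coin, lintegral_map (measurable_of_countable F) (measurable_response x), unif]
  have h : ∀ u : ℝ, F (response u x) = (Set.Iio x).indicator (fun _ => F 1) u +
      (Set.Ici x).indicator (fun _ => F (-1)) u := by
    intro u
    by_cases hu : u < x
    · simp [response, hu]
    · simp [response, hu, not_lt.1 hu]
  simp_rw [h]
  rw [lintegral_add_left (measurable_const.indicator measurableSet_Iio),
    lintegral_indicator_const measurableSet_Iio, lintegral_indicator_const measurableSet_Ici,
    Measure.restrict_apply measurableSet_Iio, Measure.restrict_apply measurableSet_Ici]
  have h1 : Set.Iio x ∩ Set.Icc 0 1 = Set.Ico 0 x := by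
    ext u
    simp only [Set.mem_inter_iff, Set.mem_Iio, Set.mem_Icc, Set.mem_Ico]
    exact ⟨fun h => ⟨h.2.1, h.1⟩, fun h => ⟨h.2, h.1, h.2.le.trans hx.2⟩⟩
  have h2 : Set.Ici x ∩ Set.Icc 0 1 = Set.Icc x 1 := by
    ext u
    simp only [Set.mem_inter_iff, Set.mem_Ici, Set.mem_Icc]
    exact ⟨fun h => ⟨h.1, h.2.2⟩, fun h => ⟨h.1, hx.1.trans h.1, h.2⟩⟩
  rw [h1, h2, Real.volume_Ico, Real.volume_Icc, sub_zero, mul_comm, mul_comm (F (-1))]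

lemma lintegral_coins_succ {x : ℝ} (hx : x ∈ Set.Icc (0 : ℝ) 1) {F : (ℕ → ℤ) → ENNReal}
    (hF : Measurable F) :
    ∫⁻ z, F z ∂coins x = ENNReal.ofReal x * ∫⁻ z, F (seqCons (1, z)) ∂coins x +
      ENNReal.ofReal (1 - x) * ∫⁻ z, F (seqCons (-1, z)) ∂coins x := by
  rw [coins, lintegral_infinitePi_succ _ hF, lintegral_coin hx]

lemma walk_zero (z : ℕ → ℤ) : walk z 0 = 0 := rfl

lemma walk_seqCons_succ (s : ℤ) (z : ℕ → ℤ) (m : ℕ) :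
    walk (seqCons (s, z)) (m + 1) = s + walk z m := by
  simp [walk, Finset.sum_range_succ', add_comm]

lemma measurable_walk (m : ℕ) : Measurable fun z : ℕ → ℤ => walk z m :=
  Finset.measurable_sum _ fun i _ => measurable_pi_apply i

/-! ### The power-one test -/

/-- The test stops when the walk is at `s` after `m` steps. -/
def Stops (η : ℝ) (m : ℕ) (s : ℤ) : Prop := 1 ≤ m ∧ boundary η m ≤ |(s : ℝ)|

lemma lt_testTime_iff {η : ℝ} {z : ℕ → ℤ} {m : ℕ} :
    (m : ℕ∞) < testTime η z ↔ ∀ j ≤ m, ¬ Stops η j (walk z j) := by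
  constructor
  · intro h j hj hs
    have : testTime η z ≤ j := iInf₂_le j hs
    exact absurd (h.trans_le this) (not_lt.2 (by exact_mod_cast hj))
  · intro h
    have : ((m + 1 : ℕ) : ℕ∞) ≤ testTime η z := by
      refine le_iInf₂ fun j hj => ?_
      have : ¬ j ≤ m := fun hjm => h j hjm hj
      exact_mod_cast not_le.1 this
    exact lt_of_lt_of_le (by exact_mod_cast Nat.lt_succ_self m) this

lemma testTime_eq_coe {η : ℝ} {z : ℕ → ℤ} {m : ℕ} (h : testTime η z = m) :
    Stops η m (walk z m) ∧ ∀ j < m, ¬ Stops η j (walk z j) := by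
  have h2 : ∀ j < m, ¬ Stops η j (walk z j) := fun j hj =>
    lt_testTime_iff.1 (by rw [h]; exact_mod_cast hj) j le_rfl
  refine ⟨?_, h2⟩
  by_contra hs
  have : (m : ℕ∞) < testTime η z := by
    refine lt_testTime_iff.2 fun j hj => ?_
    rcases hj.lt_or_eq with hj | rfl
    · exact h2 j hj
    · exact hs
  exact absurd h this.ne'

lemma measurable_testTime (η : ℝ) : Measurable (testTime η) := by
  have h : ∀ m : ℕ, MeasurableSet {z | (m : ℕ∞) < testTime η z} := by
    intro m
    simp_rw [lt_testTime_iff, Set.ofPred_forall]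
    refine .iInter fun j => .iInter fun _ => ?_
    exact measurable_walk j (MeasurableSet.of_discrete (s := {s | ¬ Stops η j s}))
  refine measurable_to_countable' fun t => ?_
  induction t using ENat.recTopCoe with
  | top =>
    have : testTime η ⁻¹' {⊤} = ⋂ m : ℕ, {z | (m : ℕ∞) < testTime η z} := by
      ext z
      simp only [Set.mem_preimage, Set.mem_singleton_iff, Set.mem_iInter, Set.mem_ofPred_eq]
      exact ENat.eq_top_iff_forall_gt
    rw [this]
    exact .iInter h
  | coe m =>
    cases m with
    | zero =>
      have : testTime η ⁻¹' {((0 : ℕ) : ℕ∞)} = {z | ((0 : ℕ) : ℕ∞) < testTime η z}ᶜ := by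
        ext z
        simp
      rw [this]
      exact (h 0).compl
    | succ m =>
      have : testTime η ⁻¹' {((m + 1 : ℕ) : ℕ∞)} =
          {z | (m : ℕ∞) < testTime η z} \ {z | ((m + 1 : ℕ) : ℕ∞) < testTime η z} := by
        ext z
        simp only [Set.mem_preimage, Set.mem_singleton_iff, Set.mem_sdiff, Set.mem_ofPred_eq, not_lt]
        rw [← ENat.add_one_le_iff (ENat.natCast_ne_top m)]
        push_cast
        exact ⟨fun h => ⟨h.ge, h.le⟩, fun h => le_antisymm h.2 h.1⟩
      rw [this]
      exact (h m).diff (h (m + 1))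

lemma measurable_decision (η : ℝ) : Measurable (decision η) := by
  have h : Measurable fun w : ℕ∞ × (ℕ → ℤ) =>
      if w.1 = ⊤ then (0 : ℤ) else Int.sign (walk w.2 w.1.toNat) := by
    refine measurable_from_prod_countable_right fun t => ?_
    by_cases ht : t = ⊤
    · simp [ht]
    · simp only [ht, if_false]
      exact (measurable_of_countable Int.sign).comp (measurable_walk _)
  exact h.comp ((measurable_testTime η).prodMk measurable_id)

lemma toENNReal_eq_tsum (t : ℕ∞) :
    (t : ENNReal) = ∑' m : ℕ, if (m : ℕ∞) < t then 1 else 0 := by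
  classical
  have h := ENNReal.tsum_set_one {m : ℕ | (m : ℕ∞) < t}
  rw [tsum_subtype _ fun _ => (1 : ENNReal)] at h
  have h2 : Set.encard {m : ℕ | (m : ℕ∞) < t} = t := by
    induction t using ENat.recTopCoe with
    | top => simp
    | coe n =>
      have : {m : ℕ | (m : ℕ∞) < n} = Finset.range n := by ext; simp
      rw [this, Set.encard_coe_eq_coe_finsetCard, Finset.card_range]
  rw [h2] at h
  rw [← h]
  exact tsum_congr fun m => by simp [Set.indicator_apply]

/-! ### The expected length of the test -/

/-- The left side equals `cosh l - 2 * l * sinh l`. Since `cosh l ≤ 1 + l ^ 2` and `l * sinh l ≥ l ^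
2`, it is at most `1 - l ^ 2`. The parameter `l` carries the sign of the drift, so no case
distinction on `x` is needed later. -/
lemma mgf_step_le {x : ℝ} (hx : x ∈ Set.Icc (0 : ℝ) 1) {l : ℝ} (hl : l = (2 * x - 1) / 2) :
    x * Real.exp (-l) + (1 - x) * Real.exp l ≤ Real.exp (-l ^ 2) := by
  have hx' : x = (1 + 2 * l) / 2 := by linarith
  have hl1 : |l| ≤ 1 / 2 := abs_le.2 ⟨by linarith [hx.1], by linarith [hx.2]⟩
  have hl2 : l ^ 2 ≤ 1 / 4 := by
    have := abs_le.1 hl1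
    nlinarith
  have e : x * Real.exp (-l) + (1 - x) * Real.exp l = Real.cosh l - 2 * l * Real.sinh l := by
    rw [Real.cosh_eq, Real.sinh_eq, hx']
    ring
  have hs : l ^ 2 ≤ l * Real.sinh l := by
    rcases le_total 0 l with h | h
    · nlinarith [Real.self_le_sinh_iff.2 h]
    · nlinarith [Real.sinh_le_self_iff.2 h]
  have hc : Real.cosh l ≤ 1 + l ^ 2 := by
    refine (Real.cosh_le_exp_half_sq l).trans ?_
    have := Real.exp_bound_div_one_sub_of_interval (x := l ^ 2 / 2) (by positivity) (by linarith)
    refine this.trans ?_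
    rw [div_le_iff₀ (by linarith)]
    nlinarith [sq_nonneg l]
  have := Real.add_one_le_exp (-l ^ 2)
  rw [e]
  linarith

lemma lintegral_exp_walk {x : ℝ} (hx : x ∈ Set.Icc (0 : ℝ) 1) (l : ℝ) (m : ℕ) :
    ∫⁻ z, ENNReal.ofReal (Real.exp (-l * walk z m)) ∂coins x =
      ENNReal.ofReal ((x * Real.exp (-l) + (1 - x) * Real.exp l) ^ m) := by
  induction m with
  | zero => simp [walk_zero]
  | succ m ih =>
    have hm : ∀ k, Measurable fun z => ENNReal.ofReal (Real.exp (-l * walk z k)) := fun k =>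
      (measurable_of_countable fun s : ℤ => ENNReal.ofReal (Real.exp (-l * s))).comp
        (measurable_walk k)
    have hs : ∀ (s : ℤ) z, ENNReal.ofReal (Real.exp (-l * walk (seqCons (s, z)) (m + 1))) =
        ENNReal.ofReal (Real.exp (-l * s)) * ENNReal.ofReal (Real.exp (-l * walk z m)) := by
      intro s z
      rw [walk_seqCons_succ, ← ENNReal.ofReal_mul (Real.exp_pos _).le, ← Real.exp_add]
      push_cast
      ring_nf
    rw [lintegral_coins_succ hx (hm (m + 1))]
    simp_rw [hs]
    rw [lintegral_const_mul _ (hm m), lintegral_const_mul _ (hm m), ih]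
    have h1 := hx.1
    have h2 := sub_nonneg.2 hx.2
    rw [← mul_assoc, ← mul_assoc, ← add_mul, ← ENNReal.ofReal_mul h1, ← ENNReal.ofReal_mul h2,
      ← ENNReal.ofReal_add (by positivity) (by positivity), ← ENNReal.ofReal_mul (by positivity)]
    congr 1
    push_cast
    ring_nf

/-- Chernoff bound: whatever the sign of the drift, `|S_m| ≤ b` forces `l * S_m ≤ |l| * b`, and
Markov's inequality applies to `exp (-l * S_m)`. -/
lemma coins_abs_walk_le {x : ℝ} (hx : x ∈ Set.Icc (0 : ℝ) 1) (m : ℕ) (b : ℝ) :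
    coins x {z | |(walk z m : ℝ)| ≤ b} ≤
      ENNReal.ofReal (Real.exp (|2 * x - 1| / 2 * b - m * (2 * x - 1) ^ 2 / 4)) := by
  set l := (2 * x - 1) / 2 with hl
  have hl' : |2 * x - 1| / 2 = |l| := by rw [hl, abs_div]; norm_num
  have hsub : {z | |(walk z m : ℝ)| ≤ b} ⊆
      {z | ENNReal.ofReal (Real.exp (-(|l| * b))) ≤
        ENNReal.ofReal (Real.exp (-l * walk z m))} := by
    intro z hz
    refine ENNReal.ofReal_le_ofReal (Real.exp_le_exp.2 ?_)
    have h1 : l * walk z m ≤ |l| * |(walk z m : ℝ)| := by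
      rw [← abs_mul]; exact le_abs_self _
    have h2 : |l| * |(walk z m : ℝ)| ≤ |l| * b := mul_le_mul_of_nonneg_left hz (abs_nonneg _)
    linarith
  have hmeas : Measurable fun z => ENNReal.ofReal (Real.exp (-l * walk z m)) :=
    (measurable_of_countable fun s : ℤ => ENNReal.ofReal (Real.exp (-l * s))).comp
      (measurable_walk m)
  have hmarkov := meas_ge_le_lintegral_div (μ := coins x) hmeas.aemeasurable
    (ε := ENNReal.ofReal (Real.exp (-(|l| * b))))
    (by simpa using Real.exp_pos _) ENNReal.ofReal_ne_top
  refine (measure_mono hsub).trans (hmarkov.trans ?_)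
  rw [lintegral_exp_walk hx, ← ENNReal.ofReal_div_of_pos (Real.exp_pos _)]
  refine ENNReal.ofReal_le_ofReal ?_
  have h0 : 0 ≤ x * Real.exp (-l) + (1 - x) * Real.exp l :=
    add_nonneg (mul_nonneg hx.1 (Real.exp_pos _).le)
      (mul_nonneg (sub_nonneg.2 hx.2) (Real.exp_pos _).le)
  rw [div_le_iff₀ (Real.exp_pos _), ← Real.exp_add]
  refine (pow_le_pow_left₀ h0 (mgf_step_le hx hl) m).trans (le_of_eq ?_)
  rw [← Real.exp_nat_mul, hl']
  congr 1
  rw [hl]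
  ring

/-- An upper bound for the number of steps after which the boundary lies below a quarter of the
drift of the walk. -/
noncomputable def burnIn (η δ : ℝ) : ℝ :=
  (128 * Real.log δ⁻¹ + (64 * (-Real.log η) + 1 + 64 * Real.log 64)) / δ ^ 2

lemma boundary_le {η δ : ℝ} (hη₀ : 0 < η) (hη₁ : η < 1) (hδ₀ : 0 < δ) (hδ₁ : δ < 1) {m : ℕ}
    (hm : burnIn η δ ≤ m) : boundary η m ≤ m * δ / 4 := by
  have hL : Real.log η < 0 := Real.log_neg hη₀ hη₁
  refine Real.sqrt_le_iff.2 ⟨by positivity, ?_⟩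
  -- The tangent bound `log y ≤ y - 1` at `y = δ ^ 2 / 64 * (m + 1)`. After doubling, its linear
  -- part uses only half of the available `m * δ ^ 2 / 16`; `burnIn` is chosen so that the other
  -- half pays for the constants.
  have hlog : Real.log ((m : ℝ) + 1) ≤ δ ^ 2 / 64 * (m + 1) + Real.log 64 + 2 * Real.log δ⁻¹ := by
    have h := Real.log_le_sub_one_of_pos (x := δ ^ 2 / 64 * (m + 1)) (by positivity)
    rw [Real.log_mul (by positivity) (by positivity), Real.log_div (by positivity) (by norm_num),
      Real.log_pow] at h
    rw [Real.log_inv]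
    push_cast at h
    linarith
  rw [burnIn, div_le_iff₀ (by positivity)] at hm
  have hδ2 : δ ^ 2 ≤ 1 := by nlinarith
  have : 2 * (Real.log ((m : ℝ) + 1) - Real.log η) ≤ m * δ ^ 2 / 16 := by linarith
  calc 2 * (m : ℝ) * (Real.log ((m : ℝ) + 1) - Real.log η)
      = m * (2 * (Real.log ((m : ℝ) + 1) - Real.log η)) := by ring
    _ ≤ m * (m * δ ^ 2 / 16) := by gcongr
    _ = (m * δ / 4) ^ 2 := by ring

/-- A walk that has not stopped after the burn-in lies within a quarter of its drift, so the
exponent in `coins_abs_walk_le` is `m δ² / 8 - m δ² / 4`. -/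
lemma coins_lt_testTime_le {η x : ℝ} (hη₀ : 0 < η) (hη₁ : η < 1) (hx : x ∈ Set.Ioo (0 : ℝ) 1)
    (hx' : x ≠ 1 / 2) {m : ℕ} (hm : burnIn η |2 * x - 1| ≤ m) :
    coins x {z | (m : ℕ∞) < testTime η z} ≤
      ENNReal.ofReal (Real.exp (-((2 * x - 1) ^ 2 / 8)) ^ m) := by
  have hδ₀ : 0 < |2 * x - 1| := abs_pos.2 fun h => hx' (by linarith)
  have hδ₁ : |2 * x - 1| < 1 := abs_lt.2 ⟨by linarith [hx.1], by linarith [hx.2]⟩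
  have hsub : {z | (m : ℕ∞) < testTime η z} ⊆
      {z | |(walk z m : ℝ)| ≤ m * |2 * x - 1| / 4} := by
    intro z hz
    rcases Nat.eq_zero_or_pos m with rfl | h1
    · simp [walk_zero]
    · have : ¬ Stops η m (walk z m) := lt_testTime_iff.1 hz m le_rfl
      have h2 : |(walk z m : ℝ)| < boundary η m := by
        by_contra h
        exact this ⟨h1, not_lt.1 h⟩
      exact h2.le.trans (boundary_le hη₀ hη₁ hδ₀ hδ₁ hm)
  refine (measure_mono hsub).trans ((coins_abs_walk_le ⟨hx.1.le, hx.2.le⟩ m _).trans ?_)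
  refine ENNReal.ofReal_le_ofReal ?_
  rw [← Real.exp_nat_mul]
  refine le_of_eq ?_
  congr 1
  have := sq_abs (2 * x - 1)
  rw [← this]
  ring

/-- The mean is the sum of the tails. They are bounded by `1` up to the burn-in and by a geometric
series afterwards. -/
lemma lintegral_testTime_le {η x : ℝ} (hη₀ : 0 < η) (hη₁ : η < 1) (hx : x ∈ Set.Ioo (0 : ℝ) 1)
    (hx' : x ≠ 1 / 2) :
    ∫⁻ z, (testTime η z : ENNReal) ∂coins x ≤
      ENNReal.ofReal (burnIn η |2 * x - 1| + 1 + (1 + 8 / (2 * x - 1) ^ 2)) := by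
  set δ := |2 * x - 1| with hδ
  have hδ₀ : 0 < δ := abs_pos.2 fun h => hx' (by linarith)
  have hδ₁ : δ < 1 := abs_lt.2 ⟨by linarith [hx.1], by linarith [hx.2]⟩
  have hsq : (2 * x - 1) ^ 2 = δ ^ 2 := (sq_abs _).symm
  have hL : Real.log η < 0 := Real.log_neg hη₀ hη₁
  have hM : 0 ≤ burnIn η δ := by
    have h1 : 0 ≤ Real.log δ⁻¹ := Real.log_nonneg ((one_le_inv₀ hδ₀).2 hδ₁.le)
    have h2 : 0 ≤ Real.log 64 := Real.log_nonneg (by norm_num)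
    refine div_nonneg ?_ (by positivity)
    linarith
  set r := Real.exp (-((2 * x - 1) ^ 2 / 8)) with hr
  set N := ⌈burnIn η δ⌉₊ with hN
  have hr₁ : r < 1 := by
    rw [hr, hsq, Real.exp_lt_one_iff]
    have := pow_pos hδ₀ 2
    linarith
  have hgeom : (1 - r)⁻¹ ≤ 1 + 8 / δ ^ 2 := by
    have hexp : r ≤ (1 + δ ^ 2 / 8)⁻¹ := by
      rw [hr, hsq, Real.exp_neg]
      exact inv_anti₀ (by positivity) (by linarith [Real.add_one_le_exp (δ ^ 2 / 8)])
    have h3 : (1 + 8 / δ ^ 2)⁻¹ ≤ 1 - r := by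
      refine le_trans (le_of_eq ?_) (sub_le_sub_left hexp 1)
      field_simp
      ring
    exact inv_le_of_inv_le₀ (by positivity) h3
  have hset : ∀ m : ℕ, MeasurableSet {z : ℕ → ℤ | (m : ℕ∞) < testTime η z} := fun m =>
    measurable_testTime η (MeasurableSet.of_discrete (s := {t | (m : ℕ∞) < t}))
  have hterm : ∀ m : ℕ, (fun z => if (m : ℕ∞) < testTime η z then (1 : ENNReal) else 0) =
      {z | (m : ℕ∞) < testTime η z}.indicator 1 := by
    intro m
    ext z
    simp [Set.indicator_apply]
  simp_rw [toENNReal_eq_tsum]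
  rw [lintegral_tsum fun m => by rw [hterm]; exact (measurable_one.indicator (hset m)).aemeasurable]
  simp_rw [hterm, lintegral_indicator_one (hset _)]
  have hb : ∀ m : ℕ, coins x {z | (m : ℕ∞) < testTime η z} ≤
      (if m < N then 1 else 0) + ENNReal.ofReal r ^ m := by
    intro m
    split_ifs with h
    · exact prob_le_one.trans le_self_add
    · rw [zero_add, ← ENNReal.ofReal_pow (Real.exp_pos _).le]
      exact coins_lt_testTime_le hη₀ hη₁ hx hx' (Nat.ceil_le.1 (not_lt.1 h))
  refine (ENNReal.tsum_le_tsum hb).trans ?_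
  rw [ENNReal.tsum_add, ENNReal.tsum_geometric]
  have h1 : ∑' m : ℕ, (if m < N then (1 : ENNReal) else 0) = N := by
    rw [tsum_eq_sum (s := Finset.range N) fun m hm => if_neg (by simpa using hm)]
    rw [Finset.sum_congr rfl fun m hm => if_pos (Finset.mem_range.1 hm)]
    simp
  rw [h1, ← ENNReal.ofReal_one, ← ENNReal.ofReal_sub _ (Real.exp_pos _).le,
    ← ENNReal.ofReal_inv_of_pos (by linarith), ← ENNReal.ofReal_natCast,
    ← ENNReal.ofReal_add (by positivity) (inv_nonneg.2 (by linarith))]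
  refine ENNReal.ofReal_le_ofReal ?_
  exact (add_le_add (Nat.ceil_lt_add_one hM).le hgeom).trans_eq (by rw [hsq])

/-- The constant in the bound for the expected length of the test. -/
noncomputable def lengthConst (η : ℝ) : ℝ := 64 * (-Real.log η) + 1 + 64 * Real.log 64 + 10

lemma lengthConst_pos {η : ℝ} (hη₀ : 0 < η) (hη₁ : η < 1) : 0 < lengthConst η := by
  have hL : Real.log η < 0 := Real.log_neg hη₀ hη₁
  have h2 : 0 ≤ Real.log 64 := Real.log_nonneg (by norm_num)
  unfold lengthConst
  linarith

lemma lintegral_testTime_le_phi {η x : ℝ} (hη₀ : 0 < η) (hη₁ : η < 1)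
    (hx : x ∈ Set.Ioo (0 : ℝ) 1) (hx' : x ≠ 1 / 2) :
    ∫⁻ z, (testTime η z : ENNReal) ∂coins x ≤
      ENNReal.ofReal (phi (128 + 2 * lengthConst η) (4 * lengthConst η) x) := by
  refine (lintegral_testTime_le hη₀ hη₁ hx hx').trans (ENNReal.ofReal_le_ofReal ?_)
  have hK := lengthConst_pos hη₀ hη₁
  set K := lengthConst η with hKdef
  rw [phi, ← sq_abs (2 * x - 1)]
  set δ := |2 * x - 1| with hδ
  have hδ₀ : 0 < δ := abs_pos.2 fun h => hx' (by linarith)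
  have hδ₁ : δ < 1 := abs_lt.2 ⟨by linarith [hx.1], by linarith [hx.2]⟩
  have hlog : 0 ≤ Real.log δ⁻¹ := Real.log_nonneg ((one_le_inv₀ hδ₀).2 hδ₁.le)
  set v := (δ ^ 2)⁻¹ with hv
  have hv1 : 1 ≤ v := (one_le_inv₀ (by positivity)).2 (by nlinarith)
  -- The summand `10` in `lengthConst` pays for `8 * v` and, as `v ≥ 1`, for the two extra units.
  have h1 : burnIn η δ + 1 + (1 + 8 / δ ^ 2) ≤ 128 * (v * Real.log δ⁻¹) + K * v := by
    have : burnIn η δ = 128 * (v * Real.log δ⁻¹) + (K - 10) * v := by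
      rw [burnIn, hv, hKdef, lengthConst, div_eq_mul_inv]
      ring
    rw [this, div_eq_mul_inv, ← hv]
    linarith
  -- `phi` has no bare term `δ⁻²`. For `δ ≤ 1 / 2` the logarithm is at least `1 / 2` and absorbs it;
  -- otherwise `δ⁻² ≤ 4` goes into the constant.
  have h2 : v ≤ 2 * (v * Real.log δ⁻¹) + 4 := by
    rcases le_total δ (1 / 2) with h | h
    · have h3 : Real.log 2 ≤ Real.log δ⁻¹ :=
        Real.log_le_log (by norm_num) (by rw [le_inv_comm₀ (by norm_num) hδ₀]; linarith)
      have h4 := Real.log_two_gt_d9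
      nlinarith
    · have : v ≤ 4 := by
        rw [hv]
        refine inv_le_of_inv_le₀ (by norm_num) ?_
        nlinarith
      have : 0 ≤ v * Real.log δ⁻¹ := by positivity
      linarith
  have h3 : K * v ≤ K * (2 * (v * Real.log δ⁻¹) + 4) := mul_le_mul_of_nonneg_left h2 hK.le
  calc _ ≤ 128 * (v * Real.log δ⁻¹) + K * v := h1
    _ ≤ 128 * (v * Real.log δ⁻¹) + K * (2 * (v * Real.log δ⁻¹) + 4) := by linarith
    _ = _ := by ring

lemma coins_testTime_eq_top {η x : ℝ} (hη₀ : 0 < η) (hη₁ : η < 1)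
    (hx : x ∈ Set.Ioo (0 : ℝ) 1) (hx' : x ≠ 1 / 2) :
    coins x {z | testTime η z = ⊤} = 0 := by
  have h := (lintegral_testTime_le hη₀ hη₁ hx hx').trans_lt ENNReal.ofReal_lt_top
  have hm : Measurable fun z => (testTime η z : ENNReal) :=
    (measurable_of_countable fun t : ℕ∞ => (t : ENNReal)).comp (measurable_testTime η)
  have := ae_lt_top hm h.ne
  rw [ae_iff] at this
  simpa using this

/-! ### The error probability of the test -/

open Classical in
/-- The probability that the test, continued for at most `n` steps after `a` responses `1` and `b`
responses `-1`, stops with sign `σ`. -/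
noncomputable def hitProb (η : ℝ) (σ : ℤ) (x : ℝ) : ℕ → ℕ → ℕ → ℝ
  | 0, a, b => if Stops η (a + b) (a - b) then (if Int.sign (a - b) = σ then 1 else 0) else 0
  | n + 1, a, b => if Stops η (a + b) (a - b) then (if Int.sign (a - b) = σ then 1 else 0)
      else x * hitProb η σ x n (a + 1) b + (1 - x) * hitProb η σ x n a (b + 1)

lemma hitProb_of_stops {η : ℝ} {σ : ℤ} {x : ℝ} {n a b : ℕ} (h : Stops η (a + b) (a - b)) :
    hitProb η σ x n a b = if Int.sign (a - b) = σ then 1 else 0 := by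
  cases n <;> simp [hitProb, h]

lemma hitProb_zero_of_not_stops {η : ℝ} {σ : ℤ} {x : ℝ} {a b : ℕ}
    (h : ¬ Stops η (a + b) (a - b)) : hitProb η σ x 0 a b = 0 := by
  simp [hitProb, h]

lemma hitProb_succ_of_not_stops {η : ℝ} {σ : ℤ} {x : ℝ} {n a b : ℕ}
    (h : ¬ Stops η (a + b) (a - b)) : hitProb η σ x (n + 1) a b =
      x * hitProb η σ x n (a + 1) b + (1 - x) * hitProb η σ x n a (b + 1) := by
  simp [hitProb, h]

lemma hitProb_nonneg {η : ℝ} {σ : ℤ} {x : ℝ} (hx : x ∈ Set.Icc (0 : ℝ) 1) (n a b : ℕ) :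
    0 ≤ hitProb η σ x n a b := by
  induction n generalizing a b with
  | zero =>
    unfold hitProb
    split_ifs <;> norm_num
  | succ n ih =>
    unfold hitProb
    have := mul_nonneg hx.1 (ih (a + 1) b)
    have := mul_nonneg (sub_nonneg.2 hx.2) (ih a (b + 1))
    split_ifs <;> positivity

lemma hitProb_le_one {η : ℝ} {σ : ℤ} {x : ℝ} (hx : x ∈ Set.Icc (0 : ℝ) 1) (n a b : ℕ) :
    hitProb η σ x n a b ≤ 1 := by
  induction n generalizing a b with
  | zero =>
    unfold hitProb
    split_ifs <;> norm_num
  | succ n ih =>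
    unfold hitProb
    have := mul_le_mul_of_nonneg_left (ih (a + 1) b) hx.1
    have := mul_le_mul_of_nonneg_left (ih a (b + 1)) (sub_nonneg.2 hx.2)
    split_ifs <;> linarith

lemma stops_neg {η : ℝ} {m : ℕ} {s : ℤ} : Stops η m (-s) ↔ Stops η m s := by
  simp [Stops]

lemma hitProb_swap (η : ℝ) (σ : ℤ) (x : ℝ) (n a b : ℕ) :
    hitProb η (-σ) (1 - x) n b a = hitProb η σ x n a b := by
  have hst : ∀ a b : ℕ, Stops η (b + a) (b - a) ↔ Stops η (a + b) (a - b) := by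
    intro a b
    rw [← stops_neg, add_comm, neg_sub]
  have hsg : ∀ a b : ℕ, Int.sign ((b : ℤ) - a) = -σ ↔ Int.sign ((a : ℤ) - b) = σ := by
    intro a b
    rw [← neg_sub, Int.sign_neg, neg_inj]
  induction n generalizing a b with
  | zero =>
    by_cases h : Stops η (a + b) (a - b)
    · rw [hitProb_of_stops h, hitProb_of_stops ((hst a b).2 h), if_congr (hsg a b) rfl rfl]
    · rw [hitProb_zero_of_not_stops h, hitProb_zero_of_not_stops (mt (hst a b).1 h)]
  | succ n ih =>
    by_cases h : Stops η (a + b) (a - b)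
    · rw [hitProb_of_stops h, hitProb_of_stops ((hst a b).2 h), if_congr (hsg a b) rfl rfl]
    · rw [hitProb_succ_of_not_stops h, hitProb_succ_of_not_stops (mt (hst a b).1 h), ih, ih]
      ring

lemma boundary_pos {η : ℝ} (hη₀ : 0 < η) (hη₁ : η < 1) {m : ℕ} (hm : 1 ≤ m) :
    0 < boundary η m := by
  have hL : Real.log η < 0 := Real.log_neg hη₀ hη₁
  have hl : 0 ≤ Real.log ((m : ℝ) + 1) := Real.log_nonneg (by linarith [m.cast_nonneg (α := ℝ)])
  have hm' : (0 : ℝ) < m := by exact_mod_cast hm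
  exact Real.sqrt_pos.2 (mul_pos (by positivity) (by linarith))

lemma Stops.ne_zero {η : ℝ} (hη₀ : 0 < η) (hη₁ : η < 1) {m : ℕ} {s : ℤ} (h : Stops η m s) :
    s ≠ 0 := by
  rintro rfl
  have := (boundary_pos hη₀ hη₁ h.1).trans_le h.2
  simp at this

/-- The more responses `1` there have been, the less likely the test stops at a negative value. -/
lemma hitProb_neg_anti {η : ℝ} (hη₀ : 0 < η) (hη₁ : η < 1) {x : ℝ} (hx : x ∈ Set.Icc (0 : ℝ) 1)
    (n : ℕ) {a b a' b' : ℕ} (hab : a + b = a' + b') (haa : a ≤ a') :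
    hitProb η (-1) x n a' b' ≤ hitProb η (-1) x n a b := by
  -- Both walks face the same boundary, which depends on time only. If the lower walk exits at a
  -- positive value, so does the upper one; if the upper walk exits at a negative value, so does the
  -- lower one.
  have hm : Stops η (a + b) (a - b) → 0 < (a : ℤ) - b → Stops η (a' + b') (a' - b') := by
    rintro ⟨h1, h2⟩ hs
    rw [hab] at h1 h2
    have : |(a : ℤ) - b| ≤ |(a' : ℤ) - b'| := by
      rw [abs_of_pos hs, abs_of_pos (by omega)]
      omega
    exact ⟨h1, h2.trans (by exact_mod_cast this)⟩
  have hm' : Stops η (a' + b') (a' - b') → (a' : ℤ) - b' < 0 → Stops η (a + b) (a - b) := by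
    rintro ⟨h1, h2⟩ hs
    rw [← hab] at h1 h2
    have : |(a' : ℤ) - b'| ≤ |(a : ℤ) - b| := by
      rw [abs_of_neg hs, abs_of_neg (by omega)]
      omega
    exact ⟨h1, h2.trans (by exact_mod_cast this)⟩
  by_cases h' : Stops η (a' + b') (a' - b')
  · rcases lt_or_ge ((a' : ℤ) - b') 0 with hs | hs
    · rw [hitProb_of_stops (hm' h' hs), if_pos (Int.sign_eq_neg_one_of_neg (by omega))]
      exact hitProb_le_one hx _ _ _
    · rw [hitProb_of_stops h', if_neg fun h => absurd (Int.sign_eq_neg_one_iff_neg.1 h) (by omega)]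
      exact hitProb_nonneg hx _ _ _
  by_cases h : Stops η (a + b) (a - b)
  · have hs : (a : ℤ) - b < 0 :=
      lt_of_le_of_ne (not_lt.1 fun hs => h' (hm h hs)) (h.ne_zero hη₀ hη₁)
    rw [hitProb_of_stops h, if_pos (Int.sign_eq_neg_one_of_neg hs)]
    exact hitProb_le_one hx _ _ _
  cases n with
  | zero => rw [hitProb_zero_of_not_stops h, hitProb_zero_of_not_stops h']
  | succ n =>
    rw [hitProb_succ_of_not_stops h, hitProb_succ_of_not_stops h']
    have h1 := hitProb_neg_anti hη₀ hη₁ hx n (a := a + 1) (b := b) (a' := a' + 1) (b' := b')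
      (by omega) (by omega)
    have h2 := hitProb_neg_anti hη₀ hη₁ hx n (a := a) (b := b + 1) (a' := a') (b' := b' + 1)
      (by omega) haa
    exact add_le_add (mul_le_mul_of_nonneg_left h1 hx.1)
      (mul_le_mul_of_nonneg_left h2 (sub_nonneg.2 hx.2))

/-- The mixture martingale of the fair walk. -/
noncomputable def mixture (a b : ℕ) : ℝ :=
  2 ^ (a + b) * (a.factorial * b.factorial) / (a + b + 1).factorial

/-- `mixture a b` is `2 ^ (a + b) * ∫ t ^ a * (1 - t) ^ b` over `[0, 1]`, the likelihood ratio of a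
coin with uniformly random bias against a fair coin. The martingale identity comes from `t + (1 - t)
= 1`. -/
lemma mixture_eq (a b : ℕ) : mixture a b = 1 / 2 * mixture (a + 1) b + 1 / 2 * mixture a (b + 1) := by
  have h3 : a + 1 + b = a + b + 1 := by ring
  have h4 : a + (b + 1) = a + b + 1 := by ring
  have h5 : ((a + b + 1).factorial : ℝ) ≠ 0 := by exact_mod_cast Nat.factorial_ne_zero _
  have h6 : ((a : ℝ) + b + 1 + 1) ≠ 0 := by positivity
  simp only [mixture, h3, h4, Nat.factorial_succ (a + b + 1), Nat.factorial_succ a,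
    Nat.factorial_succ b]
  push_cast
  field_simp
  ring

/-- The binomial coefficient appears in one term of the expansion of `(exp l + exp (-l)) ^ (a + b)`.
With `cosh l ≤ exp (l ^ 2 / 2)`, the choice `l = (a - b) / (a + b)` is optimal. -/
lemma choose_le_exp (a b : ℕ) (h : 1 ≤ a + b) :
    ((a + b).choose a : ℝ) ≤
      2 ^ (a + b) * Real.exp (-(((a : ℝ) - b) ^ 2 / (2 * (a + b)))) := by
  set l : ℝ := ((a : ℝ) - b) / (a + b) with hl
  have hm : (0 : ℝ) < a + b := by exact_mod_cast h
  have h1 : Real.exp l ^ a * Real.exp (-l) ^ b * ((a + b).choose a : ℝ) ≤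
      (Real.exp l + Real.exp (-l)) ^ (a + b) := by
    rw [add_pow]
    refine le_trans (le_of_eq ?_) (Finset.single_le_sum
      (f := fun k => Real.exp l ^ k * Real.exp (-l) ^ (a + b - k) * ((a + b).choose k : ℝ))
      (fun i _ => by positivity) (Finset.mem_range.2 (by omega : a < a + b + 1)))
    simp
  have h2 : Real.exp l + Real.exp (-l) ≤ 2 * Real.exp (l ^ 2 / 2) := by
    have := Real.cosh_le_exp_half_sq l
    rw [Real.cosh_eq] at this
    linarith
  have h3 : (Real.exp l + Real.exp (-l)) ^ (a + b) ≤
      2 ^ (a + b) * Real.exp (((a + b : ℕ) : ℝ) * (l ^ 2 / 2)) := by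
    rw [Real.exp_nat_mul, ← mul_pow]
    exact pow_le_pow_left₀ (by positivity) h2 _
  have h4 : Real.exp l ^ a * Real.exp (-l) ^ b = Real.exp (l * (a - b)) := by
    rw [← Real.exp_nat_mul, ← Real.exp_nat_mul, ← Real.exp_add]
    ring_nf
  rw [h4] at h1
  have h5 : ((a + b).choose a : ℝ) = Real.exp (-(l * (a - b))) *
      (Real.exp (l * (a - b)) * ((a + b).choose a : ℝ)) := by
    rw [← mul_assoc, ← Real.exp_add]
    simp
  rw [h5]
  refine (mul_le_mul_of_nonneg_left (h1.trans h3) (Real.exp_pos _).le).trans (le_of_eq ?_)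
  rw [mul_left_comm, ← Real.exp_add]
  congr 2
  rw [hl]
  push_cast
  field_simp
  ring

/-- The mixture equals `2 ^ m / ((m + 1) * choose m a)` with `m = a + b`. On the boundary,
`choose_le_exp` gives `choose m a ≤ 2 ^ m * η / (m + 1)`; the term `ln (m + 1)` in the boundary
cancels the factor `m + 1`. -/
lemma Stops.one_le_mixture {η : ℝ} (hη₀ : 0 < η) (hη₁ : η < 1) {a b : ℕ}
    (h : Stops η (a + b) (a - b)) : 1 ≤ η * mixture a b := by
  obtain ⟨h1, h2⟩ := h
  have hL : Real.log η < 0 := Real.log_neg hη₀ hη₁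
  have hm : (0 : ℝ) < a + b := by exact_mod_cast h1
  have hb := (Real.sqrt_le_left (abs_nonneg _)).1 h2
  rw [sq_abs] at hb
  push_cast at hb
  set E := ((a : ℝ) - b) ^ 2 / (2 * (a + b)) with hE
  have h3 : Real.log ((a : ℝ) + b + 1) - Real.log η ≤ E := by
    rw [hE, le_div_iff₀ (by positivity)]
    linarith
  have h4 : ((a : ℝ) + b + 1) / η ≤ Real.exp E := by
    rw [← Real.log_le_iff_le_exp (by positivity), Real.log_div (by positivity) hη₀.ne']
    exact h3
  have hc := choose_le_exp a b h1
  rw [← hE] at hc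
  have hfact : ((a + b).choose a : ℝ) * (a.factorial * b.factorial) = (a + b).factorial := by
    have := Nat.choose_mul_factorial_mul_factorial (Nat.le_add_right a b)
    rw [Nat.add_sub_cancel_left] at this
    rw [← mul_assoc]
    exact_mod_cast this
  have hab : (0 : ℝ) < a.factorial * b.factorial := by positivity
  have h5 : Real.exp E * ((a + b).choose a : ℝ) ≤ 2 ^ (a + b) := by
    refine (mul_le_mul_of_nonneg_left hc (Real.exp_pos E).le).trans (le_of_eq ?_)
    rw [mul_left_comm, ← Real.exp_add]
    simp
  have h6 : ((a : ℝ) + b + 1) / η * ((a + b).choose a : ℝ) ≤ 2 ^ (a + b) :=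
    (mul_le_mul_of_nonneg_right h4 (Nat.cast_nonneg _)).trans h5
  rw [mixture, ← mul_div_assoc, le_div_iff₀ (by positivity), one_mul, Nat.factorial_succ]
  push_cast
  rw [← hfact]
  rw [div_mul_eq_mul_div, div_le_iff₀ hη₀] at h6
  calc ((a : ℝ) + b + 1) * (((a + b).choose a : ℝ) * (a.factorial * b.factorial))
      = ((a : ℝ) + b + 1) * ((a + b).choose a : ℝ) * (a.factorial * b.factorial) := by ring
    _ ≤ 2 ^ (a + b) * η * (a.factorial * b.factorial) := mul_le_mul_of_nonneg_right h6 hab.le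
    _ = _ := by ring

/-- Optional stopping at a finite horizon for the nonnegative martingale `η * mixture`, which
dominates the indicator of having stopped. -/
lemma hitProb_add_le_mixture {η : ℝ} (hη₀ : 0 < η) (hη₁ : η < 1) (n a b : ℕ) :
    hitProb η 1 (1 / 2) n a b + hitProb η (-1) (1 / 2) n a b ≤ η * mixture a b := by
  have h0 : ∀ a b, 0 ≤ mixture a b := fun a b => by unfold mixture; positivity
  have hbase : ∀ (n a b : ℕ), Stops η (a + b) (a - b) →
      hitProb η 1 (1 / 2) n a b + hitProb η (-1) (1 / 2) n a b ≤ η * mixture a b := by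
    intro n a b h
    refine le_trans ?_ (h.one_le_mixture hη₀ hη₁)
    rw [hitProb_of_stops h, hitProb_of_stops h]
    split_ifs with h1 h2
    · rw [h1] at h2; norm_num at h2
    all_goals norm_num
  induction n generalizing a b with
  | zero =>
    by_cases h : Stops η (a + b) (a - b)
    · exact hbase 0 a b h
    · rw [hitProb_zero_of_not_stops h, hitProb_zero_of_not_stops h, add_zero]
      exact mul_nonneg hη₀.le (h0 a b)
  | succ n ih =>
    by_cases h : Stops η (a + b) (a - b)
    · exact hbase (n + 1) a b h
    · rw [hitProb_succ_of_not_stops h, hitProb_succ_of_not_stops h, mixture_eq]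
      linarith [ih (a + 1) b, ih a (b + 1)]

lemma hitProb_neg_half_le {η : ℝ} (hη₀ : 0 < η) (hη₁ : η < 1) (n : ℕ) :
    hitProb η (-1) (1 / 2) n 0 0 ≤ η / 2 := by
  have h := hitProb_add_le_mixture hη₀ hη₁ n 0 0
  have hs := hitProb_swap η 1 (1 / 2) n 0 0
  norm_num [mixture] at h hs
  linarith

/-- Raising `x` moves weight from the continuation after a response `-1` to the one after a response
`1`, which by `hitProb_neg_anti` is the less likely to end at a negative value. -/
lemma hitProb_neg_le_half {η : ℝ} (hη₀ : 0 < η) (hη₁ : η < 1) {x : ℝ}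
    (hx : x ∈ Set.Icc (1 / 2 : ℝ) 1) (n a b : ℕ) :
    hitProb η (-1) x n a b ≤ hitProb η (-1) (1 / 2) n a b := by
  induction n generalizing a b with
  | zero => rfl
  | succ n ih =>
    by_cases h : Stops η (a + b) (a - b)
    · rw [hitProb_of_stops h, hitProb_of_stops h]
    · rw [hitProb_succ_of_not_stops h, hitProb_succ_of_not_stops h]
      have h1 := mul_le_mul_of_nonneg_left (ih (a + 1) b) (by linarith [hx.1] : 0 ≤ x)
      have h2 := mul_le_mul_of_nonneg_left (ih a (b + 1)) (sub_nonneg.2 hx.2)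
      have h3 := hitProb_neg_anti hη₀ hη₁ (x := 1 / 2) (by norm_num) n
        (a := a) (b := b + 1) (a' := a + 1) (b' := b) (by ring) (Nat.le_succ a)
      nlinarith [hx.1]

lemma hitProb_neg_le {η : ℝ} (hη₀ : 0 < η) (hη₁ : η < 1) {x : ℝ}
    (hx : x ∈ Set.Icc (1 / 2 : ℝ) 1) (n : ℕ) : hitProb η (-1) x n 0 0 ≤ η / 2 :=
  (hitProb_neg_le_half hη₀ hη₁ hx n 0 0).trans (hitProb_neg_half_le hη₀ hη₁ n)

lemma hitProb_pos_le {η : ℝ} (hη₀ : 0 < η) (hη₁ : η < 1) {x : ℝ}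
    (hx : x ∈ Set.Icc (0 : ℝ) (1 / 2)) (n : ℕ) : hitProb η 1 x n 0 0 ≤ η / 2 := by
  rw [← hitProb_swap]
  exact hitProb_neg_le hη₀ hη₁ ⟨by linarith [hx.2], by linarith [hx.1]⟩ n

/-- The test, continued for at most `n` steps from the value `s` of the walk after `m` steps, stops
with sign `σ`. -/
def hitSet (η : ℝ) (σ : ℤ) (n m : ℕ) (s : ℤ) : Set (ℕ → ℤ) :=
  {z | ∃ j ≤ n, Stops η (m + j) (s + walk z j) ∧ (∀ i < j, ¬ Stops η (m + i) (s + walk z i)) ∧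
    Int.sign (s + walk z j) = σ}

lemma measurableSet_hitSet (η : ℝ) (σ : ℤ) (n m : ℕ) (s : ℤ) :
    MeasurableSet (hitSet η σ n m s) := by
  have h : hitSet η σ n m s = ⋃ j : ℕ, ⋃ _ : j ≤ n,
      ({z | Stops η (m + j) (s + walk z j)} ∩ (⋂ i : ℕ, ⋂ _ : i < j,
        {z | ¬ Stops η (m + i) (s + walk z i)})) ∩ {z | Int.sign (s + walk z j) = σ} := by
    ext z
    simp only [hitSet, Set.mem_ofPred_eq, Set.mem_iUnion, Set.mem_inter_iff, Set.mem_iInter,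
      exists_prop, and_assoc]
  rw [h]
  have hw : ∀ j (S : Set ℤ), MeasurableSet {z : ℕ → ℤ | walk z j ∈ S} := fun j S =>
    measurable_walk j (MeasurableSet.of_discrete (s := S))
  refine .iUnion fun j => .iUnion fun _ => .inter (.inter ?_ (.iInter fun i => .iInter fun _ => ?_)) ?_
  · exact hw j {w | Stops η (m + j) (s + w)}
  · exact hw i {w | ¬ Stops η (m + i) (s + w)}
  · exact hw j {w | Int.sign (s + w) = σ}

lemma coins_succ {x : ℝ} (hx : x ∈ Set.Icc (0 : ℝ) 1) {H : Set (ℕ → ℤ)} (hH : MeasurableSet H) :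
    coins x H = ENNReal.ofReal x * coins x {z | seqCons (1, z) ∈ H} +
      ENNReal.ofReal (1 - x) * coins x {z | seqCons (-1, z) ∈ H} := by
  have hs : ∀ s : ℤ, MeasurableSet {z : ℕ → ℤ | seqCons (s, z) ∈ H} := fun s =>
    (measurable_seqCons.comp (measurable_const.prodMk measurable_id)) hH
  have h := lintegral_coins_succ hx (F := H.indicator 1) (measurable_one.indicator hH)
  rw [lintegral_indicator_one hH] at h
  have h2 : ∀ s : ℤ, ∫⁻ z, H.indicator 1 (seqCons (s, z)) ∂coins x =
      coins x {z | seqCons (s, z) ∈ H} := fun s => by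
    rw [← lintegral_indicator_one (hs s)]
    rfl
  rw [h, h2, h2]

/-- First-step analysis identifies the recursion `hitProb` with the law of the walk; only an upper
bound is needed. -/
lemma coins_hitSet_le {η : ℝ} {σ : ℤ} {x : ℝ} (hx : x ∈ Set.Icc (0 : ℝ) 1) (n a b : ℕ) :
    coins x (hitSet η σ n (a + b) (a - b)) ≤ ENNReal.ofReal (hitProb η σ x n a b) := by
  have hbase : ∀ (n a b : ℕ), Stops η (a + b) (a - b) →
      coins x (hitSet η σ n (a + b) (a - b)) ≤ ENNReal.ofReal (hitProb η σ x n a b) := by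
    intro n a b h
    rw [hitProb_of_stops h]
    split_ifs with hs
    · simpa using prob_le_one
    · refine le_of_eq ?_
      have : hitSet η σ n (a + b) (a - b) = ∅ := by
        refine Set.eq_empty_of_forall_notMem ?_
        rintro z ⟨j, -, -, h2, h3⟩
        rcases Nat.eq_zero_or_pos j with rfl | hj
        · exact hs (by simpa [walk_zero] using h3)
        · exact h2 0 hj (by simpa [walk_zero] using h)
      simp [this]
  induction n generalizing a b with
  | zero =>
    by_cases h : Stops η (a + b) (a - b)
    · exact hbase 0 a b h
    · have : hitSet η σ 0 (a + b) (a - b) = ∅ := by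
        refine Set.eq_empty_of_forall_notMem ?_
        rintro z ⟨j, hj, h1, -, -⟩
        obtain rfl : j = 0 := by omega
        exact h (by simpa [walk_zero] using h1)
      simp [this]
  | succ n ih =>
    by_cases h : Stops η (a + b) (a - b)
    · exact hbase (n + 1) a b h
    · have hsub : ∀ s : ℤ, {z | seqCons (s, z) ∈ hitSet η σ (n + 1) (a + b) (a - b)} ⊆
          hitSet η σ n (a + b + 1) (a - b + s) := by
        rintro s z ⟨j, hj, h1, h2, h3⟩
        cases j with
        | zero => exact absurd (by simpa [walk_zero] using h1) h
        | succ j =>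
          rw [walk_seqCons_succ, ← add_assoc, ← add_assoc, add_right_comm (a + b)] at h1
          rw [walk_seqCons_succ, ← add_assoc] at h3
          refine ⟨j, by omega, h1, fun i hi => ?_, h3⟩
          have := h2 (i + 1) (by omega)
          rwa [walk_seqCons_succ, ← add_assoc, ← add_assoc, add_right_comm (a + b)] at this
      have h1 : coins x {z | seqCons (1, z) ∈ hitSet η σ (n + 1) (a + b) (a - b)} ≤
          ENNReal.ofReal (hitProb η σ x n (a + 1) b) := by
        refine (measure_mono (hsub 1)).trans (le_trans (le_of_eq ?_) (ih (a + 1) b))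
        congr 2 <;> push_cast <;> ring
      have h2 : coins x {z | seqCons (-1, z) ∈ hitSet η σ (n + 1) (a + b) (a - b)} ≤
          ENNReal.ofReal (hitProb η σ x n a (b + 1)) := by
        refine (measure_mono (hsub (-1))).trans (le_trans (le_of_eq ?_) (ih a (b + 1)))
        congr 2
        push_cast
        ring
      rw [coins_succ hx (measurableSet_hitSet η σ _ _ _), hitProb_succ_of_not_stops h]
      have n1 := hitProb_nonneg (η := η) (σ := σ) hx n (a + 1) b
      have n2 := hitProb_nonneg (η := η) (σ := σ) hx n a (b + 1)
      have x0 := hx.1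
      have x1 := sub_nonneg.2 hx.2
      rw [ENNReal.ofReal_add (by positivity) (by positivity), ENNReal.ofReal_mul x0,
        ENNReal.ofReal_mul x1]
      gcongr

lemma coins_decision_le {η : ℝ} {σ : ℤ} (hσ : σ ≠ 0) {x : ℝ} (hx : x ∈ Set.Icc (0 : ℝ) 1) {c : ℝ}
    (hc : ∀ n, hitProb η σ x n 0 0 ≤ c) :
    coins x {z | decision η z = σ} ≤ ENNReal.ofReal c := by
  have hsub : {z | decision η z = σ} ⊆ ⋃ n, hitSet η σ n 0 0 := by
    intro z hz
    rw [Set.mem_ofPred_eq, decision] at hz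
    split_ifs at hz with h
    · exact absurd hz.symm hσ
    · obtain ⟨m, hm⟩ := ENat.ne_top_iff_exists.1 h
      obtain ⟨h1, h2⟩ := testTime_eq_coe hm.symm
      rw [← hm, ENat.toNat_natCast] at hz
      exact Set.mem_iUnion.2 ⟨m, m, le_rfl, by simpa using h1, by simpa using h2, by simpa using hz⟩
  have hmono : Monotone fun n => hitSet η σ n 0 0 := by
    rintro n n' hn z ⟨j, hj, h⟩
    exact ⟨j, hj.trans hn, h⟩
  refine (measure_mono hsub).trans ?_
  rw [hmono.measure_iUnion]
  refine iSup_le fun n => ?_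
  have := coins_hitSet_le (η := η) (σ := σ) hx n 0 0
  simp only [Nat.cast_zero, add_zero, sub_zero] at this
  exact this.trans (ENNReal.ofReal_le_ofReal (hc n))

lemma decision_mem (η : ℝ) (hη₀ : 0 < η) (hη₁ : η < 1) (z : ℕ → ℤ) :
    decision η z = 1 ∨ decision η z = -1 ∨ (decision η z = 0 ∧ testTime η z = ⊤) := by
  rw [decision]
  split_ifs with h
  · exact Or.inr (Or.inr ⟨rfl, h⟩)
  · obtain ⟨m, hm⟩ := ENat.ne_top_iff_exists.1 h
    have h1 := (testTime_eq_coe hm.symm).1.ne_zero hη₀ hη₁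
    rw [← hm, ENat.toNat_natCast]
    rcases lt_or_gt_of_ne h1 with h2 | h2
    · exact Or.inr (Or.inl (Int.sign_eq_neg_one_of_neg h2))
    · exact Or.inl (Int.sign_eq_one_of_pos h2)

/-! ### Densities, medians and updates -/

/-- A density of a probability distribution on `[-b, b]`. -/
structure IsDensityOn (b : ℝ) (ρ : ℝ → ℝ) : Prop where
  measurable : Measurable ρ
  eq_zero : ∀ t, t ∉ Set.Icc (-b) b → ρ t = 0
  mass_one : densityMeasure ρ Set.univ = 1

instance (ρ : ℝ → ℝ) : NullSingletonClass (densityMeasure ρ) := by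
  unfold densityMeasure
  infer_instance

namespace IsDensityOn

variable {b : ℝ} {ρ : ℝ → ℝ}

lemma isProbabilityMeasure (h : IsDensityOn b ρ) : IsProbabilityMeasure (densityMeasure ρ) :=
  ⟨h.mass_one⟩

lemma measure_eq_zero (h : IsDensityOn b ρ) {S : Set ℝ} (hS : MeasurableSet S)
    (hd : Disjoint S (Set.Icc (-b) b)) : densityMeasure ρ S = 0 := by
  rw [densityMeasure, withDensity_apply _ hS,
    setLIntegral_congr_fun (g := fun _ => 0) hS fun t ht => by
      simp [h.eq_zero t (Set.disjoint_left.1 hd ht)]]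
  simp

/-- The infimum leaves mass at most `1 / 2` strictly below the median and at least `1 / 2` up to it.
There are no atoms, so both are exactly `1 / 2`; this is why an update at the median preserves the
total mass. -/
lemma median_spec (h : IsDensityOn b ρ) :
    median ρ ∈ Set.Icc (-b) b ∧ densityMeasure ρ (Set.Iio (median ρ)) = 1 / 2 ∧
      densityMeasure ρ (Set.Ici (median ρ)) = 1 / 2 := by
  have := h.isProbabilityMeasure
  set S : Set ℝ := {x | 1 / 2 ≤ densityMeasure ρ (Set.Iic x)} with hS
  have hbS : b ∈ S := by
    have h0 : densityMeasure ρ (Set.Ioi b) = 0 := h.measure_eq_zero measurableSet_Ioi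
      (Set.disjoint_left.2 fun t ht ht' => not_lt.2 ht'.2 ht)
    have h1 : densityMeasure ρ (Set.Iic b) = 1 := by
      rw [← prob_compl_eq_zero_iff measurableSet_Iic, Set.compl_Iic, h0]
    change 1 / 2 ≤ densityMeasure ρ (Set.Iic b)
    rw [h1]
    exact ENNReal.half_le_self
  have hlow : ∀ x ∈ S, -b ≤ x := by
    intro x hx
    by_contra hlt
    have h0 : densityMeasure ρ (Set.Iic x) = 0 := h.measure_eq_zero measurableSet_Iic
      (Set.disjoint_left.2 fun t ht ht' => hlt (ht'.1.trans ht))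
    change 1 / 2 ≤ densityMeasure ρ (Set.Iic x) at hx
    rw [h0] at hx
    simp at hx
  have hbdd : BddBelow S := ⟨-b, hlow⟩
  have hmed : median ρ = sInf S := rfl
  have hle : densityMeasure ρ (Set.Iio (median ρ)) ≤ 1 / 2 := by
    have hU : Set.Iio (median ρ) = ⋃ n : ℕ, Set.Iic (median ρ - 1 / ((n : ℝ) + 1)) := by
      ext t
      simp only [Set.mem_Iio, Set.mem_iUnion, Set.mem_Iic]
      constructor
      · intro ht
        obtain ⟨n, hn⟩ := exists_nat_one_div_lt (sub_pos.2 ht)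
        exact ⟨n, by linarith⟩
      · rintro ⟨n, hn⟩
        have : 0 < 1 / ((n : ℝ) + 1) := Nat.one_div_pos_of_nat
        linarith
    have hmono : Monotone fun n : ℕ => Set.Iic (median ρ - 1 / ((n : ℝ) + 1)) := fun n m hnm =>
      Set.Iic_subset_Iic.2 (sub_le_sub_left (Nat.one_div_le_one_div hnm) _)
    rw [hU, hmono.measure_iUnion]
    refine iSup_le fun n => le_of_lt ?_
    by_contra hn
    have h1 : median ρ - 1 / ((n : ℝ) + 1) ∈ S := not_lt.1 hn
    have h2 := csInf_le hbdd h1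
    have : 0 < 1 / ((n : ℝ) + 1) := Nat.one_div_pos_of_nat
    linarith
  have hge : 1 / 2 ≤ densityMeasure ρ (Set.Iic (median ρ)) := by
    have hI : Set.Iic (median ρ) = ⋂ n : ℕ, Set.Iic (median ρ + 1 / ((n : ℝ) + 1)) := by
      ext t
      simp only [Set.mem_Iic, Set.mem_iInter]
      constructor
      · intro ht n
        have : 0 < 1 / ((n : ℝ) + 1) := Nat.one_div_pos_of_nat
        linarith
      · intro ht
        by_contra hlt
        obtain ⟨n, hn⟩ := exists_nat_one_div_lt (sub_pos.2 (not_le.1 hlt))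
        linarith [ht n]
    have hanti : Antitone fun n : ℕ => Set.Iic (median ρ + 1 / ((n : ℝ) + 1)) := fun n m hnm =>
      Set.Iic_subset_Iic.2 (add_le_add_right (Nat.one_div_le_one_div hnm) _)
    rw [hI, hanti.measure_iInter (fun n => measurableSet_Iic.nullMeasurableSet)
      ⟨0, measure_ne_top _ _⟩]
    refine le_iInf fun n => ?_
    have : 0 < 1 / ((n : ℝ) + 1) := Nat.one_div_pos_of_nat
    obtain ⟨s, hs, hs'⟩ := exists_lt_of_csInf_lt ⟨b, hbS⟩
      (show sInf S < median ρ + 1 / ((n : ℝ) + 1) by rw [← hmed]; linarith)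
    have hs1 : 1 / 2 ≤ densityMeasure ρ (Set.Iic s) := hs
    exact hs1.trans (measure_mono (Set.Iic_subset_Iic.2 hs'.le))
  rw [← Iio_ae_eq_Iic.measure_eq] at hge
  have hhalf := le_antisymm hle hge
  refine ⟨⟨le_csInf ⟨b, hbS⟩ hlow, csInf_le hbdd hbS⟩, hhalf, ?_⟩
  rw [← Set.compl_Iio, prob_compl_eq_one_sub measurableSet_Iio, hhalf]
  simp

end IsDensityOn

/-- The half-line which gains mass when the decision is `s`. -/
def gainSide (s : ℤ) (x : ℝ) : Set ℝ := if s = 1 then Set.Ici x else Set.Iio x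

lemma measurableSet_gainSide (s : ℤ) (x : ℝ) : MeasurableSet (gainSide s x) := by
  unfold gainSide
  split_ifs
  exacts [measurableSet_Ici, measurableSet_Iio]

lemma compl_gainSide {s : ℤ} (hs : s = 1 ∨ s = -1) (x : ℝ) :
    (gainSide s x)ᶜ = gainSide (-s) x := by
  rcases hs with rfl | rfl <;> simp [gainSide]

lemma update_eq {s : ℤ} (hs : s = 1 ∨ s = -1) (p : ℝ) (ρ : ℝ → ℝ) (x : ℝ) :
    update p ρ x s = (gainSide s x).indicator (fun t => 2 * p * ρ t) +
      (gainSide (-s) x).indicator (fun t => 2 * (1 - p) * ρ t) := by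
  ext t
  by_cases h : x ≤ t
  · rcases hs with rfl | rfl <;> simp [update, gainSide, h]
  · rcases hs with rfl | rfl <;> simp [update, gainSide, h, not_le.1 h]

lemma update_zero (p : ℝ) (ρ : ℝ → ℝ) (x : ℝ) : update p ρ x 0 = ρ := by
  ext t
  simp [update]

lemma measurable_update {s : ℤ} (hs : s = 1 ∨ s = -1) (p : ℝ) {ρ : ℝ → ℝ} (hρ : Measurable ρ)
    (x : ℝ) : Measurable (update p ρ x s) := by
  rw [update_eq hs]
  exact ((hρ.const_mul _).indicator (measurableSet_gainSide _ _)).add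
    ((hρ.const_mul _).indicator (measurableSet_gainSide _ _))

lemma densityMeasure_update {s : ℤ} (hs : s = 1 ∨ s = -1) {p : ℝ} (hp : p ∈ Set.Icc (0 : ℝ) 1)
    {ρ : ℝ → ℝ} (hρ : Measurable ρ) (x : ℝ) {S : Set ℝ} (hS : MeasurableSet S) :
    densityMeasure (update p ρ x s) S =
      ENNReal.ofReal (2 * p) * densityMeasure ρ (S ∩ gainSide s x) +
        ENNReal.ofReal (2 * (1 - p)) * densityMeasure ρ (S ∩ gainSide (-s) x) := by
  have hp0 := hp.1
  have hp1 := sub_nonneg.2 hp.2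
  have hm : Measurable fun t => ENNReal.ofReal (ρ t) := hρ.ennreal_ofReal
  have h : ∀ t, ENNReal.ofReal (update p ρ x s t) =
      (gainSide s x).indicator (fun t => ENNReal.ofReal (2 * p) * ENNReal.ofReal (ρ t)) t +
      (gainSide (-s) x).indicator
        (fun t => ENNReal.ofReal (2 * (1 - p)) * ENNReal.ofReal (ρ t)) t := by
    intro t
    rw [update_eq hs, Pi.add_apply, ← compl_gainSide hs]
    by_cases ht : t ∈ gainSide s x
    · simp [ht, ENNReal.ofReal_mul (show 0 ≤ 2 * p by positivity)]
    · simp [ht, ENNReal.ofReal_mul (show 0 ≤ 2 * (1 - p) by positivity)]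
  simp only [densityMeasure]
  rw [withDensity_apply _ hS]
  simp_rw [h]
  rw [lintegral_add_left ((hm.const_mul _).indicator (measurableSet_gainSide _ _)),
    lintegral_indicator (measurableSet_gainSide _ _),
    lintegral_indicator (measurableSet_gainSide _ _),
    Measure.restrict_restrict (measurableSet_gainSide _ _),
    Measure.restrict_restrict (measurableSet_gainSide _ _), lintegral_const_mul _ hm,
    lintegral_const_mul _ hm, withDensity_apply _ (hS.inter (measurableSet_gainSide _ _)),
    withDensity_apply _ (hS.inter (measurableSet_gainSide _ _)), Set.inter_comm S,
    Set.inter_comm S]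

lemma IsDensityOn.update_median {b : ℝ} {ρ : ℝ → ℝ} (h : IsDensityOn b ρ) {p : ℝ}
    (hp : p ∈ Set.Icc (0 : ℝ) 1) {s : ℤ} (hs : s = 1 ∨ s = -1 ∨ s = 0) :
    IsDensityOn b (update p ρ (median ρ) s) := by
  rw [← or_assoc] at hs
  rcases hs with hs | rfl
  · refine ⟨measurable_update hs p h.measurable _, fun t ht => ?_, ?_⟩
    · classical
      simp [update_eq hs, h.eq_zero t ht, Set.indicator_apply]
    · rw [densityMeasure_update hs hp h.measurable _ .univ, Set.univ_inter, Set.univ_inter]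
      obtain ⟨-, h1, h2⟩ := h.median_spec
      have h3 : ∀ r, densityMeasure ρ (gainSide r (median ρ)) = 1 / 2 := by
        intro r
        unfold gainSide
        split_ifs
        exacts [h2, h1]
      rw [h3, h3, ← add_mul, ← ENNReal.ofReal_add (by linarith [hp.1]) (by linarith [hp.2])]
      ring_nf
      rw [ENNReal.ofReal_ofNat]
      rw [one_div]
      exact ENNReal.mul_inv_cancel two_ne_zero ENNReal.ofNat_ne_top
  · rwa [update_zero]

/-- The mass of a set under the distribution with density `ρ`. -/
noncomputable def mass (ρ : ℝ → ℝ) (S : Set ℝ) : ℝ := (densityMeasure ρ S).toReal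

lemma mass_nonneg (ρ : ℝ → ℝ) (S : Set ℝ) : 0 ≤ mass ρ S := ENNReal.toReal_nonneg

namespace IsDensityOn

variable {b : ℝ} {ρ : ℝ → ℝ}

lemma mass_update (h : IsDensityOn b ρ) {s : ℤ} (hs : s = 1 ∨ s = -1) {p : ℝ}
    (hp : p ∈ Set.Icc (0 : ℝ) 1) (x : ℝ) {S : Set ℝ} (hS : MeasurableSet S) :
    mass (update p ρ x s) S =
      2 * p * mass ρ (S ∩ gainSide s x) + 2 * (1 - p) * mass ρ (S ∩ gainSide (-s) x) := by
  have := h.isProbabilityMeasure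
  have hp0 := hp.1
  have hp1 := sub_nonneg.2 hp.2
  rw [mass, densityMeasure_update hs hp h.measurable x hS, ENNReal.toReal_add
    (ENNReal.mul_ne_top ENNReal.ofReal_ne_top (measure_ne_top _ _))
    (ENNReal.mul_ne_top ENNReal.ofReal_ne_top (measure_ne_top _ _)), ENNReal.toReal_mul,
    ENNReal.toReal_mul, ENNReal.toReal_ofReal (by positivity),
    ENNReal.toReal_ofReal (by positivity)]
  rfl

lemma mass_eq_add (h : IsDensityOn b ρ) {s : ℤ} (hs : s = 1 ∨ s = -1) (x : ℝ) (S : Set ℝ) :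
    mass ρ S = mass ρ (S ∩ gainSide s x) + mass ρ (S ∩ gainSide (-s) x) := by
  have := h.isProbabilityMeasure
  rw [mass, ← measure_inter_add_sdiff S (measurableSet_gainSide s x), Set.sdiff_eq,
    compl_gainSide hs, ENNReal.toReal_add (measure_ne_top _ _) (measure_ne_top _ _)]
  rfl

lemma mass_gainSide_median (h : IsDensityOn b ρ) (s : ℤ) :
    mass ρ (gainSide s (median ρ)) = 1 / 2 := by
  obtain ⟨-, h1, h2⟩ := h.median_spec
  unfold mass gainSide
  split_ifs
  · rw [h2]; simp
  · rw [h1]; simp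

lemma mass_add_le_one (h : IsDensityOn b ρ) {A N : Set ℝ} (hN : MeasurableSet N)
    (hd : Disjoint A N) : mass ρ A + mass ρ N ≤ 1 := by
  have := h.isProbabilityMeasure
  rw [mass, mass, ← ENNReal.toReal_add (measure_ne_top _ _) (measure_ne_top _ _),
    ← measure_union hd hN]
  exact ENNReal.toReal_le_of_le_ofReal (by norm_num) (by simpa using prob_le_one)

end IsDensityOn

/-! ### The drift of the potential -/

/-- The relative decrease of the odds of the far region per query in it. -/
noncomputable def oddsDrift (η p : ℝ) : ℝ := (2 * p - 1) * (1 - p - η / 2) / (2 * p * (1 - p))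

/-- The relative decrease of the square root of the odds of the far region per query in it. -/
noncomputable def sqrtDrift (η p : ℝ) : ℝ := 1 - Real.sqrt (1 - oddsDrift η p)

lemma sqrtDrift_pos {η p : ℝ} (hη₀ : 0 < η) (hp : 1 / 2 < p) (hp' : p < 1 - η / 2) :
    0 < sqrtDrift η p := by
  have h1 : 0 < oddsDrift η p := by
    unfold oddsDrift
    have : 0 < 1 - p := by linarith
    have : 0 < 2 * p - 1 := by linarith
    have : 0 < 1 - p - η / 2 := by linarith
    positivity
  have := Real.sqrt_lt_sqrt_iff_of_pos (x := 1 - oddsDrift η p) one_pos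
  rw [Real.sqrt_one] at this
  have := this.2 (by linarith)
  unfold sqrtDrift
  linarith

lemma sqrt_convexCombo_le {w r s : ℝ} (hw : w ∈ Set.Icc (0 : ℝ) 1) (hr : 0 ≤ r) (hs : 0 ≤ s) :
    (1 - w) * Real.sqrt r + w * Real.sqrt s ≤ Real.sqrt ((1 - w) * r + w * s) := by
  refine Real.le_sqrt_of_sq_le ?_
  have h1 := Real.sq_sqrt hr
  have h2 := Real.sq_sqrt hs
  have h3 : 0 ≤ w * (1 - w) * (Real.sqrt r - Real.sqrt s) ^ 2 :=
    mul_nonneg (mul_nonneg hw.1 (sub_nonneg.2 hw.2)) (sq_nonneg _)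
  have e : (1 - w) * Real.sqrt r ^ 2 + w * Real.sqrt s ^ 2 -
      ((1 - w) * Real.sqrt r + w * Real.sqrt s) ^ 2 =
        w * (1 - w) * (Real.sqrt r - Real.sqrt s) ^ 2 := by ring
  rw [h1, h2] at e
  linarith

/-- Between the far region and `θ*`, the odds do not increase on average. -/
lemma odds_mid_le {η p w f n₁ n₂ : ℝ} (hη₀ : 0 < η) (hp : 1 / 2 < p) (hp' : p < 1 - η / 2)
    (hw' : w ≤ η / 2) (hf : 0 ≤ f) (hn₁ : 0 ≤ n₁) (hn₂ : 0 ≤ n₂)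
    (hn : 0 < n₁ + n₂) :
    (1 - w) * (2 * (1 - p) * f / (2 * p * n₂ + 2 * (1 - p) * n₁)) +
      w * (2 * p * f / (2 * p * n₁ + 2 * (1 - p) * n₂)) ≤ f / (n₁ + n₂) := by
  have hq : 0 < 1 - p := by linarith
  have hp0 : 0 < p := by linarith
  have hA : 0 < p * n₂ + (1 - p) * n₁ := by
    rcases hn₁.eq_or_lt with h | h
    · rw [← h] at hn ⊢; nlinarith
    · positivity
  have hB : 0 < p * n₁ + (1 - p) * n₂ := by
    rcases hn₁.eq_or_lt with h | h
    · rw [← h] at hn ⊢; nlinarith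
    · positivity
  have e1 : 2 * (1 - p) * f / (2 * p * n₂ + 2 * (1 - p) * n₁) =
      f * ((1 - p) / (p * n₂ + (1 - p) * n₁)) := by field_simp
  have e2 : 2 * p * f / (2 * p * n₁ + 2 * (1 - p) * n₂) =
      f * (p / (p * n₁ + (1 - p) * n₂)) := by field_simp
  -- After clearing denominators the slack is `(2p - 1)² n₁ n₂ + (1 - p - w)(2p - 1) n₂ (n₁ + n₂)`,
  -- where `w ≤ η / 2 < 1 - p`.
  have key : (1 - w) * ((1 - p) / (p * n₂ + (1 - p) * n₁)) + w * (p / (p * n₁ + (1 - p) * n₂)) ≤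
      1 / (n₁ + n₂) := by
    rw [← mul_div_assoc, ← mul_div_assoc, div_add_div _ _ hA.ne' hB.ne',
      div_le_div_iff₀ (mul_pos hA hB) hn]
    have h1 : 0 ≤ (1 - p - w) * ((2 * p - 1) * n₂) :=
      mul_nonneg (by linarith) (mul_nonneg (by linarith) hn₂)
    have h2 : 0 ≤ (2 * p - 1) ^ 2 * (n₁ * n₂) := by positivity
    have h3 := mul_nonneg h1 hn.le
    nlinarith
  rw [e1, e2]
  calc _ = f * ((1 - w) * ((1 - p) / (p * n₂ + (1 - p) * n₁)) +
        w * (p / (p * n₁ + (1 - p) * n₂))) := by ring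
    _ ≤ f * (1 / (n₁ + n₂)) := mul_le_mul_of_nonneg_left key hf
    _ = _ := by ring

/-- In the far region, the odds decrease by a constant factor on average. -/
lemma odds_far_le {η p w f n : ℝ} (hη₀ : 0 < η) (hp : 1 / 2 < p) (hp' : p < 1 - η / 2)
    (hw' : w ≤ η / 2) (hf : f ≤ 1 / 2) (hn : 0 < n) :
    (1 - w) * ((2 * p * f + 2 * (1 - p) * (1 / 2)) / (2 * p * n)) +
      w * ((2 * p * (1 / 2) + 2 * (1 - p) * f) / (2 * (1 - p) * n)) ≤
        (1 - oddsDrift η p) * ((1 / 2 + f) / n) := by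
  have hq : 0 < 1 - p := by linarith
  have hp0 : 0 < p := by linarith
  have hc : 0 ≤ oddsDrift η p := by
    unfold oddsDrift
    have : 0 ≤ 2 * p - 1 := by linarith
    have : 0 ≤ 1 - p - η / 2 := by linarith
    positivity
  -- The left side is affine and increasing in `w`, with equality at `w = η / 2`. This determines
  -- `oddsDrift`.
  have key : (1 - w) * (f + (1 - p) / (2 * p)) + w * (f + p / (2 * (1 - p))) ≤
      1 / 2 + f - oddsDrift η p := by
    have e : 1 / 2 + f - oddsDrift η p - ((1 - w) * (f + (1 - p) / (2 * p)) +
        w * (f + p / (2 * (1 - p)))) = (2 * p - 1) * (η / 2 - w) / (2 * p * (1 - p)) := by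
      unfold oddsDrift
      field_simp
      ring
    have : 0 ≤ (2 * p - 1) * (η / 2 - w) / (2 * p * (1 - p)) :=
      div_nonneg (mul_nonneg (by linarith) (by linarith)) (by positivity)
    linarith
  -- Since `1 / 2 + f ≤ 1`, the additive decrease is also a multiplicative one.
  have key2 : 1 / 2 + f - oddsDrift η p ≤ (1 - oddsDrift η p) * (1 / 2 + f) := by nlinarith
  calc _ = ((1 - w) * (f + (1 - p) / (2 * p)) + w * (f + p / (2 * (1 - p)))) / n := by
        field_simp
        ring
    _ ≤ ((1 - oddsDrift η p) * (1 / 2 + f)) / n :=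
        div_le_div_of_nonneg_right (key.trans key2) hn.le
    _ = _ := by ring

/-! ### The chain of densities -/

/-- One stage of the algorithm, driven by the numbers `v`. -/
noncomputable def stage (p η : ℝ) (pr : ℝ → ℝ) (ρ : ℝ → ℝ) (v : ℕ → ℝ) : ℝ → ℝ :=
  update p ρ (median ρ) (decision η fun i => response (v i) (pr (median ρ)))

/-- The Markov property: after one stage the algorithm restarts from the updated density with the
shifted array. -/
lemma posterior_succ (p η : ℝ) (pr ρ : ℝ → ℝ) (u : ℕ → ℕ → ℝ) (k : ℕ) :
    posterior p η pr ρ u (k + 1) =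
      posterior p η pr (stage p η pr ρ (u 0)) (fun j => u (j + 1)) k := by
  induction k with
  | zero => rfl
  | succ k ih =>
    rw [posterior, ih]
    rfl

/-- The law of the numbers which drive one stage. -/
noncomputable def rowLaw : Measure (ℕ → ℝ) := Measure.infinitePi fun _ => unif

/-- The law of the numbers which drive the algorithm. -/
noncomputable def arrayLaw : Measure (ℕ → ℕ → ℝ) := Measure.infinitePi fun _ => rowLaw

instance : IsProbabilityMeasure rowLaw := by unfold rowLaw; infer_instance

instance : IsProbabilityMeasure arrayLaw := by unfold arrayLaw; infer_instance

lemma measurable_responses (x : ℝ) :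
    Measurable fun (v : ℕ → ℝ) (i : ℕ) => response (v i) x :=
  measurable_pi_iff.2 fun i => (measurable_response x).comp (measurable_pi_apply i)

/-- The randomness of one stage reaches the density only through an integer decision. Measurability
therefore follows by splitting over countably many values, without a σ-algebra on the space of
densities. -/
lemma measurable_comp_posterior (p η : ℝ) (pr : ℝ → ℝ) {Q : (ℝ → ℝ) → (ℕ → ℝ) → ENNReal}
    (hQ : ∀ ρ, Measurable (Q ρ)) (k : ℕ) (ρ : ℝ → ℝ) :
    Measurable fun u : ℕ → ℕ → ℝ => Q (posterior p η pr ρ u k) (u k) := by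
  induction k generalizing ρ with
  | zero => exact (hQ ρ).comp (measurable_pi_apply 0)
  | succ k ih =>
    simp_rw [posterior_succ]
    have h1 : Measurable fun w : ℤ × (ℕ → ℕ → ℝ) =>
        Q (posterior p η pr (update p ρ (median ρ) w.1) w.2 k) (w.2 k) :=
      measurable_from_prod_countable_right fun s => ih (update p ρ (median ρ) s)
    have h2 : Measurable fun u : ℕ → ℕ → ℝ =>
        decision η fun i => response (u 0 i) (pr (median ρ)) :=
      (measurable_decision η).comp ((measurable_responses _).comp (measurable_pi_apply 0))
    have h3 : Measurable fun (u : ℕ → ℕ → ℝ) (j : ℕ) => u (j + 1) :=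
      measurable_pi_iff.2 fun j => measurable_pi_apply (j + 1)
    exact h1.comp (h2.prodMk h3)

/-- Lyapunov argument: the expected drop of `Ψ` in one stage pays for the expected cost `Q`. Finite
horizons follow by conditioning on the first stage, and the bound passes to the full series. -/
lemma lintegral_tsum_le_of_drift (p η : ℝ) (pr : ℝ → ℝ) {Q : (ℝ → ℝ) → (ℕ → ℝ) → ENNReal}
    (hQ : ∀ ρ, Measurable (Q ρ)) {C : (ℝ → ℝ) → Prop} {Ψ : (ℝ → ℝ) → ENNReal}
    (hC : ∀ ρ v, C ρ → C (stage p η pr ρ v))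
    (hΨ : ∀ ρ, C ρ → ∫⁻ v, Q ρ v + Ψ (stage p η pr ρ v) ∂rowLaw ≤ Ψ ρ)
    {ρ : ℝ → ℝ} (hρ : C ρ) :
    ∫⁻ u, ∑' k, Q (posterior p η pr ρ u k) (u k) ∂arrayLaw ≤ Ψ ρ := by
  have hm := fun k ρ => measurable_comp_posterior p η pr hQ k ρ
  have hfin : ∀ n ρ, C ρ →
      ∫⁻ u, ∑ k ∈ Finset.range n, Q (posterior p η pr ρ u k) (u k) ∂arrayLaw ≤ Ψ ρ := by
    intro n
    induction n with
    | zero => intro ρ _; simp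
    | succ n ih =>
      intro ρ hρ
      rw [arrayLaw, lintegral_infinitePi_succ _ (Finset.measurable_sum _ fun k _ => hm k ρ)]
      refine le_trans (lintegral_mono fun v => ?_) (hΨ ρ hρ)
      change ∫⁻ u, _ ∂arrayLaw ≤ _
      simp_rw [Finset.sum_range_succ', posterior_succ, seqCons_succ, seqCons_zero]
      change ∫⁻ u, _ + Q ρ v ∂arrayLaw ≤ _
      rw [lintegral_add_right _ measurable_const, add_comm, lintegral_const, measure_univ, mul_one]
      gcongr
      exact ih _ (hC ρ v hρ)
  rw [lintegral_tsum fun k => (hm k ρ).aemeasurable]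
  refine ENNReal.tsum_le_of_sum_range_le fun n => ?_
  rw [← lintegral_finsetSum _ fun k _ => hm k ρ]
  exact hfin n ρ hρ

lemma lintegral_comp_decision {η : ℝ} (hη₀ : 0 < η) (hη₁ : η < 1) (x : ℝ) (g : ℤ → ENNReal)
    {s : ℤ} (hs : s = 1 ∨ s = -1) :
    ∫⁻ v, g (decision η fun i => response (v i) x) ∂rowLaw =
      coins x {z | decision η z = s} * g s + coins x {z | decision η z = -s} * g (-s) +
        coins x {z | decision η z = 0} * g 0 := by
  have hg : Measurable fun z => g (decision η z) :=
    (measurable_of_countable g).comp (measurable_decision η)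
  have hset : ∀ r : ℤ, MeasurableSet {z | decision η z = r} := fun r =>
    measurable_decision η (measurableSet_singleton r)
  rw [← lintegral_map (f := fun z => g (decision η z)) hg (measurable_responses x), rowLaw,
    map_response_infinitePi]
  have h : ∀ z, g (decision η z) = {z | decision η z = s}.indicator (fun _ => g s) z +
      {z | decision η z = -s}.indicator (fun _ => g (-s)) z +
      {z | decision η z = 0}.indicator (fun _ => g 0) z := by
    intro z
    rcases hs with rfl | rfl <;> rcases decision_mem η hη₀ hη₁ z with hz | hz | ⟨hz, -⟩ <;>
      simp [hz]
  simp_rw [h]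
  rw [lintegral_add_right _ (measurable_const.indicator (hset 0)),
    lintegral_add_right _ (measurable_const.indicator (hset (-s))),
    lintegral_indicator_const (hset s), lintegral_indicator_const (hset (-s)),
    lintegral_indicator_const (hset 0), mul_comm (g s), mul_comm (g (-s)), mul_comm (g 0)]

lemma stage_eq_or (p : ℝ) {η : ℝ} (hη₀ : 0 < η) (hη₁ : η < 1) (pr ρ : ℝ → ℝ) (v : ℕ → ℝ) :
    ∃ s : ℤ, (s = 1 ∨ s = -1 ∨ s = 0) ∧ stage p η pr ρ v = update p ρ (median ρ) s := by
  refine ⟨_, ?_, rfl⟩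
  rcases decision_mem η hη₀ hη₁ fun i => response (v i) (pr (median ρ)) with h | h | ⟨h, -⟩ <;>
    simp [h]

/-! ### The number of comparisons in the far region -/

/-- The odds of the far region `A` against the near region `N`. -/
noncomputable def odds (A N : Set ℝ) (ρ : ℝ → ℝ) : ℝ := mass ρ A / mass ρ N

lemma odds_nonneg (A N : Set ℝ) (ρ : ℝ → ℝ) : 0 ≤ odds A N ρ :=
  div_nonneg (mass_nonneg _ _) (mass_nonneg _ _)

/-- The far region `A` and the near region `N` lie on the same side of `θ*`, and `s` is the
direction of `θ*` as seen from there. -/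
structure IsFarNear (θs : ℝ) (s : ℤ) (A N : Set ℝ) : Prop where
  sign : s = 1 ∨ s = -1
  measurable_far : MeasurableSet A
  measurable_near : MeasurableSet N
  disjoint : Disjoint A N
  far : ∀ x ∈ A, θs ∉ gainSide (-s) x ∧ θs ≠ x ∧ gainSide (-s) x ⊆ A ∧
    N ∩ gainSide (-s) x = ∅
  not_far : ∀ x, x ∉ A → A ∩ gainSide s x = ∅
  beyond : ∀ x, θs ∈ gainSide (-s) x ∨ θs = x → ∀ ρ, mass ρ (N ∩ gainSide s x) = 0

/-- The probability `x` that the right point is selected is informative at a point from which `θ*`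
lies in the direction `s`. -/
def Informative (s : ℤ) (x : ℝ) : Prop :=
  x ∈ Set.Ioo (0 : ℝ) 1 ∧ x ≠ 1 / 2 ∧ (s = 1 → 1 / 2 ≤ x) ∧ (s = -1 → x ≤ 1 / 2)

lemma Informative.coins_decision_neg_le {η : ℝ} (hη₀ : 0 < η) (hη₁ : η < 1) {s : ℤ}
    (hs : s = 1 ∨ s = -1) {x : ℝ} (h : Informative s x) :
    coins x {z | decision η z = -s} ≤ ENNReal.ofReal (η / 2) := by
  obtain ⟨hx, -, h1, h2⟩ := h
  rcases hs with rfl | rfl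
  · exact coins_decision_le (by norm_num) ⟨hx.1.le, hx.2.le⟩ fun n =>
      hitProb_neg_le hη₀ hη₁ ⟨h1 rfl, hx.2.le⟩ n
  · exact coins_decision_le (by norm_num) ⟨hx.1.le, hx.2.le⟩ fun n =>
      hitProb_pos_le hη₀ hη₁ ⟨hx.1.le, h2 rfl⟩ n

lemma Informative.coins_decision_zero {η : ℝ} (hη₀ : 0 < η) (hη₁ : η < 1) {s : ℤ} {x : ℝ}
    (h : Informative s x) : coins x {z | decision η z = 0} = 0 := by
  refine measure_mono_null (fun z hz => ?_) (coins_testTime_eq_top hη₀ hη₁ h.1 h.2.1)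
  rcases decision_mem η hη₀ hη₁ z with h1 | h1 | ⟨-, h1⟩
  · rw [Set.mem_ofPred_eq, h1] at hz; norm_num at hz
  · rw [Set.mem_ofPred_eq, h1] at hz; norm_num at hz
  · exact h1

lemma coins_decision_sum {η : ℝ} (hη₀ : 0 < η) (hη₁ : η < 1) (x : ℝ) {s : ℤ}
    (hs : s = 1 ∨ s = -1) :
    (coins x {z | decision η z = s}).toReal + (coins x {z | decision η z = -s}).toReal +
      (coins x {z | decision η z = 0}).toReal = 1 := by
  have h := lintegral_comp_decision hη₀ hη₁ x (fun _ => 1) hs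
  simp only [lintegral_const, measure_univ, mul_one] at h
  rw [← ENNReal.toReal_add (measure_ne_top _ _) (measure_ne_top _ _),
    ← ENNReal.toReal_add (by finiteness) (measure_ne_top _ _), ← h, ENNReal.toReal_one]

open Classical in
/-- The square root of the odds decreases on average, and strictly so in the far region. -/
lemma sqrt_odds_drift {η p θs b : ℝ} {s : ℤ} {A N : Set ℝ} {ρ : ℝ → ℝ} {x : ℝ} (hη₀ : 0 < η)
    (hη₁ : η < 1) (hp : 1 / 2 < p) (hp' : p < 1 - η / 2) (hAN : IsFarNear θs s A N)
    (hρ : IsDensityOn b ρ) (hN : 0 < mass ρ N)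
    (hx : θs ∉ gainSide (-s) (median ρ) → θs ≠ median ρ → Informative s x) :
    (coins x {z | decision η z = s}).toReal * √(odds A N (update p ρ (median ρ) s)) +
      (coins x {z | decision η z = -s}).toReal * √(odds A N (update p ρ (median ρ) (-s))) +
      (coins x {z | decision η z = 0}).toReal * √(odds A N (update p ρ (median ρ) 0)) +
      (if median ρ ∈ A then sqrtDrift η p else 0) ≤ √(odds A N ρ) := by
  have hp01 : p ∈ Set.Icc (0 : ℝ) 1 := ⟨by linarith, by linarith⟩
  have hp0 : 0 < p := by linarith
  have hq : 0 < 1 - p := by linarith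
  have hs := hAN.sign
  have hs' : -s = 1 ∨ -s = -1 := by omega
  have hsum := coins_decision_sum hη₀ hη₁ x hs
  rw [update_zero]
  have hodds1 : odds A N (update p ρ (median ρ) s) =
      (2 * p * mass ρ (A ∩ gainSide s (median ρ)) +
        2 * (1 - p) * mass ρ (A ∩ gainSide (-s) (median ρ))) /
      (2 * p * mass ρ (N ∩ gainSide s (median ρ)) +
        2 * (1 - p) * mass ρ (N ∩ gainSide (-s) (median ρ))) := by
    rw [odds, hρ.mass_update hs hp01 _ hAN.measurable_far,
      hρ.mass_update hs hp01 _ hAN.measurable_near]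
  have hodds2 : odds A N (update p ρ (median ρ) (-s)) =
      (2 * p * mass ρ (A ∩ gainSide (-s) (median ρ)) +
        2 * (1 - p) * mass ρ (A ∩ gainSide s (median ρ))) /
      (2 * p * mass ρ (N ∩ gainSide (-s) (median ρ)) +
        2 * (1 - p) * mass ρ (N ∩ gainSide s (median ρ))) := by
    rw [odds, hρ.mass_update hs' hp01 _ hAN.measurable_far,
      hρ.mass_update hs' hp01 _ hAN.measurable_near, neg_neg]
  have hA := hρ.mass_eq_add hs (median ρ) A
  have hN' := hρ.mass_eq_add hs (median ρ) N
  have hr1 := odds_nonneg A N (update p ρ (median ρ) s)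
  have hr2 := odds_nonneg A N (update p ρ (median ρ) (-s))
  -- Here `A` and `N` are multiplied by the same factor, so nothing is required of the test. This
  -- covers a query exactly at `θs`, where the test may never stop.
  by_cases hb : θs ∈ gainSide (-s) (median ρ) ∨ θs = median ρ
  · have hnA : median ρ ∉ A := fun h => by
      obtain ⟨h1, h2, -⟩ := hAN.far _ h
      exact hb.elim h1 h2
    have hA0 : mass ρ (A ∩ gainSide s (median ρ)) = 0 := by
      rw [hAN.not_far _ hnA]; simp [mass]
    have hN0 := hAN.beyond _ hb ρ
    rw [hA0, zero_add] at hA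
    rw [hN0, zero_add] at hN'
    have e1 : odds A N (update p ρ (median ρ) s) = odds A N ρ := by
      rw [hodds1, hA0, hN0, odds, ← hA, ← hN', mul_zero, zero_add, zero_add,
        mul_div_mul_left _ _ (by positivity)]
    have e2 : odds A N (update p ρ (median ρ) (-s)) = odds A N ρ := by
      rw [hodds2, hA0, hN0, odds, ← hA, ← hN', mul_zero, add_zero, add_zero,
        mul_div_mul_left _ _ (by positivity)]
    rw [e1, e2, if_neg hnA, add_zero, ← add_mul, ← add_mul, hsum, one_mul]
  · rw [not_or] at hb
    have hinf := hx hb.1 hb.2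
    have hw := ENNReal.toReal_mono ENNReal.ofReal_ne_top
      (hinf.coins_decision_neg_le hη₀ hη₁ hs)
    rw [ENNReal.toReal_ofReal (by positivity)] at hw
    have hw0 : 0 ≤ (coins x {z | decision η z = -s}).toReal := ENNReal.toReal_nonneg
    rw [hinf.coins_decision_zero hη₀ hη₁, ENNReal.toReal_zero, add_zero] at hsum
    rw [hinf.coins_decision_zero hη₀ hη₁, ENNReal.toReal_zero, zero_mul, add_zero]
    set w := (coins x {z | decision η z = -s}).toReal with hwdef
    have hw1 : w ∈ Set.Icc (0 : ℝ) 1 := ⟨hw0, by linarith⟩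
    have hws : (coins x {z | decision η z = s}).toReal = 1 - w := by linarith
    rw [hws]
    -- Concavity of the root reduces the drift of the potential to the drift of the odds.
    have hj := sqrt_convexCombo_le hw1 hr1 hr2
    by_cases hmA : median ρ ∈ A
    · obtain ⟨-, -, h1, h2⟩ := hAN.far _ hmA
      have hA2 : mass ρ (A ∩ gainSide (-s) (median ρ)) = 1 / 2 := by
        rw [Set.inter_eq_right.2 h1, hρ.mass_gainSide_median]
      have hN2 : mass ρ (N ∩ gainSide (-s) (median ρ)) = 0 := by
        rw [h2]; simp [mass]
      have hle := hρ.mass_add_le_one hAN.measurable_near hAN.disjoint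
      rw [hA2] at hA
      rw [hN2, add_zero] at hN'
      have hfar := odds_far_le hη₀ hp hp' hw (f := mass ρ (A ∩ gainSide s (median ρ)))
        (by linarith) hN
      have e1 : odds A N (update p ρ (median ρ) s) =
          (2 * p * mass ρ (A ∩ gainSide s (median ρ)) + 2 * (1 - p) * (1 / 2)) /
            (2 * p * mass ρ N) := by
        rw [hodds1, hA2, hN2, mul_zero, add_zero, ← hN']
      have e2 : odds A N (update p ρ (median ρ) (-s)) =
          (2 * p * (1 / 2) + 2 * (1 - p) * mass ρ (A ∩ gainSide s (median ρ))) /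
            (2 * (1 - p) * mass ρ N) := by
        rw [hodds2, hA2, hN2, mul_zero, zero_add, ← hN']
      have e3 : odds A N ρ = (1 / 2 + mass ρ (A ∩ gainSide s (median ρ))) / mass ρ N := by
        rw [odds, hA, add_comm]
      rw [← e1, ← e2, ← e3] at hfar
      -- A median in `A` puts at least half of the mass into `A`, so the relative decrease of the
      -- root is an absolute decrease of at least `sqrtDrift`.
      have hone : 1 ≤ √(odds A N ρ) := by
        refine Real.one_le_sqrt.2 ((one_le_div hN).2 ?_)
        have := mass_nonneg ρ (A ∩ gainSide s (median ρ))
        linarith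
      have h3 : √((1 - oddsDrift η p) * odds A N ρ) = (1 - sqrtDrift η p) * √(odds A N ρ) := by
        rw [Real.sqrt_mul' _ (odds_nonneg _ _ _), sqrtDrift, sub_sub_cancel]
      have h4 := hj.trans (Real.sqrt_le_sqrt hfar)
      rw [h3] at h4
      rw [if_pos hmA]
      have := sqrtDrift_pos hη₀ hp hp'
      nlinarith
    · have hA0 : mass ρ (A ∩ gainSide s (median ρ)) = 0 := by
        rw [hAN.not_far _ hmA]; simp [mass]
      rw [hA0, zero_add] at hA
      have hmid := odds_mid_le hη₀ hp hp' hw (mass_nonneg ρ A)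
        (mass_nonneg ρ (N ∩ gainSide (-s) (median ρ)))
        (mass_nonneg ρ (N ∩ gainSide s (median ρ))) (by linarith)
      have e1 : odds A N (update p ρ (median ρ) s) = 2 * (1 - p) * mass ρ A /
          (2 * p * mass ρ (N ∩ gainSide s (median ρ)) +
            2 * (1 - p) * mass ρ (N ∩ gainSide (-s) (median ρ))) := by
        rw [hodds1, hA0, ← hA, mul_zero, zero_add]
      have e2 : odds A N (update p ρ (median ρ) (-s)) = 2 * p * mass ρ A /
          (2 * p * mass ρ (N ∩ gainSide (-s) (median ρ)) +
            2 * (1 - p) * mass ρ (N ∩ gainSide s (median ρ))) := by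
        rw [hodds2, hA0, ← hA, mul_zero, add_zero]
      have e3 : odds A N ρ = mass ρ A / (mass ρ (N ∩ gainSide (-s) (median ρ)) +
          mass ρ (N ∩ gainSide s (median ρ))) := by
        rw [odds, hN', add_comm (mass ρ (N ∩ gainSide s (median ρ)))]
      rw [← e1, ← e2, ← e3] at hmid
      rw [if_neg hmA, add_zero]
      exact hj.trans (Real.sqrt_le_sqrt hmid)

lemma mass_update_pos {p b : ℝ} (hp : 1 / 2 < p) (hp' : p < 1) {ρ : ℝ → ℝ} (hρ : IsDensityOn b ρ)
    {N : Set ℝ} (hN : MeasurableSet N) (hpos : 0 < mass ρ N) {s : ℤ}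
    (hs : s = 1 ∨ s = -1 ∨ s = 0) (x : ℝ) : 0 < mass (update p ρ x s) N := by
  rw [← or_assoc] at hs
  rcases hs with hs | rfl
  · rw [hρ.mass_update hs ⟨by linarith, hp'.le⟩ x hN]
    rw [hρ.mass_eq_add hs x N] at hpos
    have h1 := mass_nonneg ρ (N ∩ gainSide s x)
    have h2 := mass_nonneg ρ (N ∩ gainSide (-s) x)
    nlinarith
  · rwa [update_zero]

open Classical in
/-- The expected number of comparisons at query points in the far region. -/
lemma lintegral_far_le {η p θs b : ℝ} {s : ℤ} {A N : Set ℝ} {ρ pr : ℝ → ℝ} (hη₀ : 0 < η)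
    (hη₁ : η < 1) (hp : 1 / 2 < p) (hp' : p < 1 - η / 2) (hAN : IsFarNear θs s A N)
    (hρ : IsDensityOn b ρ) (hN : 0 < mass ρ N)
    (hpr : ∀ x ∈ Set.Icc (-b) b, θs ∉ gainSide (-s) x → θs ≠ x → Informative s (pr x))
    {K : ENNReal}
    (hK : ∀ x ∈ Set.Icc (-b) b, x ∈ A → ∫⁻ z, (testTime η z : ENNReal) ∂coins (pr x) ≤ K) :
    ∫⁻ u, ∑' k, (if query p η pr ρ u k ∈ A then (testLength p η pr ρ u k : ENNReal) else 0)
      ∂arrayLaw ≤ K * ENNReal.ofReal ((sqrtDrift η p)⁻¹ * √(odds A N ρ)) := by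
  have hκ := sqrtDrift_pos hη₀ hp hp'
  set Q : (ℝ → ℝ) → (ℕ → ℝ) → ENNReal := fun ρ v => if median ρ ∈ A then
    ((testTime η fun i => response (v i) (pr (median ρ)) : ℕ∞) : ENNReal) else 0 with hQdef
  have hTm : Measurable fun z : ℕ → ℤ => (testTime η z : ENNReal) :=
    (measurable_of_countable fun t : ℕ∞ => (t : ENNReal)).comp (measurable_testTime η)
  have hQ : ∀ ρ, Measurable (Q ρ) := by
    intro ρ
    simp only [hQdef]
    split_ifs
    · exact hTm.comp (measurable_responses _)
    · exact measurable_const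
  refine lintegral_tsum_le_of_drift p η pr hQ (C := fun ρ => IsDensityOn b ρ ∧ 0 < mass ρ N)
    (Ψ := fun ρ => K * ENNReal.ofReal ((sqrtDrift η p)⁻¹ * √(odds A N ρ))) ?_ ?_ ⟨hρ, hN⟩
  · rintro ρ v ⟨h1, h2⟩
    obtain ⟨r, hr, hst⟩ := stage_eq_or p hη₀ hη₁ pr ρ v
    rw [hst]
    exact ⟨h1.update_median ⟨by linarith, by linarith⟩ hr,
      mass_update_pos hp (by linarith) h1 hAN.measurable_near h2 hr _⟩
  · rintro ρ ⟨h1, h2⟩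
    have hmed := h1.median_spec.1
    have hdrift := sqrt_odds_drift hη₀ hη₁ hp hp' hAN h1 h2 (hpr _ hmed)
    rw [lintegral_add_left (hQ ρ)]
    have hcost : ∫⁻ v, Q ρ v ∂rowLaw ≤ K * (if median ρ ∈ A then 1 else 0) := by
      simp only [hQdef]
      split_ifs with h
      · rw [mul_one]
        refine le_trans (le_of_eq ?_) (hK _ hmed h)
        rw [← map_response_infinitePi, lintegral_map hTm (measurable_responses _)]
        rfl
      · simp
    have hnext := lintegral_comp_decision hη₀ hη₁ (pr (median ρ))
      (fun r => K * ENNReal.ofReal ((sqrtDrift η p)⁻¹ * √(odds A N (update p ρ (median ρ) r))))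
      hAN.sign
    change (∫⁻ v, Q ρ v ∂rowLaw) + ∫⁻ v, K * ENNReal.ofReal ((sqrtDrift η p)⁻¹ *
      √(odds A N (update p ρ (median ρ) (decision η fun i => response (v i) (pr (median ρ))))))
        ∂rowLaw ≤ _
    rw [hnext]
    refine (add_le_add hcost le_rfl).trans ?_
    have hw : ∀ (c : ENNReal) (r : ℝ), c ≠ ⊤ → c * (K * ENNReal.ofReal ((sqrtDrift η p)⁻¹ * r)) =
        K * ENNReal.ofReal ((sqrtDrift η p)⁻¹ * (c.toReal * r)) := by
      intro c r hc
      rw [mul_left_comm (sqrtDrift η p)⁻¹, ENNReal.ofReal_mul ENNReal.toReal_nonneg,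
        ENNReal.ofReal_toReal hc, mul_left_comm]
    have hi : (if median ρ ∈ A then (1 : ENNReal) else 0) =
        ENNReal.ofReal ((sqrtDrift η p)⁻¹ * (if median ρ ∈ A then sqrtDrift η p else 0)) := by
      split_ifs
      · rw [inv_mul_cancel₀ hκ.ne', ENNReal.ofReal_one]
      · simp
    rw [hw _ _ (measure_ne_top _ _), hw _ _ (measure_ne_top _ _), hw _ _ (measure_ne_top _ _), hi,
      ← mul_add, ← mul_add, ← mul_add, ← ENNReal.ofReal_add (by positivity) (by positivity),
      ← ENNReal.ofReal_add (by positivity) (by positivity),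
      ← ENNReal.ofReal_add (by split_ifs <;> positivity) (by positivity), ← mul_add, ← mul_add,
      ← mul_add]
    gcongr
    rw [add_comm]
    exact hdrift

/-! ### The regions on the two sides of `θ*` -/

lemma isFarNear_left {θs a : ℝ} (ha : 0 < a) :
    IsFarNear θs 1 (Set.Iic (θs - a)) (Set.Ioc (θs - a) θs) where
  sign := Or.inl rfl
  measurable_far := measurableSet_Iic
  measurable_near := measurableSet_Ioc
  disjoint := Set.disjoint_left.2 fun _ h h' => not_lt.2 h h'.1
  far x hx := by
    have hx' : x ≤ θs - a := hx
    have hg : gainSide (-1) x = Set.Iio x := by simp [gainSide]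
    rw [hg]
    refine ⟨fun h => ?_, fun h => ?_, fun t ht => ht.le.trans hx', ?_⟩
    · have : θs < x := h
      linarith
    · linarith
    · refine Set.eq_empty_of_forall_notMem fun t ht => ?_
      have h1 : θs - a < t := ht.1.1
      have h2 : t < x := ht.2
      linarith
  not_far x hx := by
    refine Set.eq_empty_of_forall_notMem fun t ht => hx ?_
    have h1 : t ≤ θs - a := ht.1
    have h2 : x ≤ t := by simpa [gainSide] using ht.2
    exact h2.trans h1
  beyond x hx ρ := by
    have hx' : θs ≤ x := by
      rcases hx with h | h
      · have : θs < x := by simpa [gainSide] using h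
        exact this.le
      · exact h.le
    -- The point `θs` itself may belong to both sets. It is a null set, which is why `beyond` speaks
    -- of mass and not of emptiness.
    have hsub : Set.Ioc (θs - a) θs ∩ gainSide 1 x ⊆ {θs} := by
      rintro t ⟨ht, ht'⟩
      have : x ≤ t := by simpa [gainSide] using ht'
      exact le_antisymm ht.2 (hx'.trans this)
    rw [mass, measure_mono_null hsub (measure_singleton θs), ENNReal.toReal_zero]

lemma isFarNear_right {θs a : ℝ} (ha : 0 < a) :
    IsFarNear θs (-1) (Set.Ici (θs + a)) (Set.Ico θs (θs + a)) where
  sign := Or.inr rfl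
  measurable_far := measurableSet_Ici
  measurable_near := measurableSet_Ico
  disjoint := Set.disjoint_left.2 fun _ h h' => not_lt.2 h h'.2
  far x hx := by
    have hx' : θs + a ≤ x := hx
    have hg : gainSide (- -1) x = Set.Ici x := by simp [gainSide]
    rw [hg]
    refine ⟨fun h => ?_, fun h => ?_, fun t ht => hx'.trans ht, ?_⟩
    · have : x ≤ θs := h
      linarith
    · linarith
    · refine Set.eq_empty_of_forall_notMem fun t ht => ?_
      have h1 : t < θs + a := ht.1.2
      have h2 : x ≤ t := ht.2
      linarith
  not_far x hx := by
    refine Set.eq_empty_of_forall_notMem fun t ht => hx ?_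
    have h1 : θs + a ≤ t := ht.1
    have h2 : t < x := by simpa [gainSide] using ht.2
    exact h1.trans h2.le
  beyond x hx ρ := by
    have hx' : x ≤ θs := by
      rcases hx with h | h
      · simpa [gainSide] using h
      · exact h.ge
    have hsub : Set.Ico θs (θs + a) ∩ gainSide (-1) x ⊆ ∅ := by
      rintro t ⟨ht, ht'⟩
      have h1 : t < x := by simpa [gainSide] using ht'
      exact absurd (h1.trans_le hx') (not_lt.2 ht.1)
    rw [mass, measure_mono_null hsub measure_empty, ENNReal.toReal_zero]

/-! ### The human comparisons -/

lemma pMinus_mem_Ioo (d : ℝ → ℝ → ℝ) (θs γ : ℝ) (cm cp : ℝ → ℝ) (θ : ℝ) :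
    pMinus d θs γ cm cp θ ∈ Set.Ioo (0 : ℝ) 1 := by
  have := Real.exp_pos ((utility d θs (cp θ) - utility d θs (cm θ)) / γ)
  exact ⟨inv_pos.2 (by linarith), inv_lt_one_of_one_lt₀ (by linarith)⟩

lemma pPlus_mem_Ioo (d : ℝ → ℝ → ℝ) (θs γ : ℝ) (cm cp : ℝ → ℝ) (θ : ℝ) :
    pPlus d θs γ cm cp θ ∈ Set.Ioo (0 : ℝ) 1 := by
  obtain ⟨h1, h2⟩ := pMinus_mem_Ioo d θs γ cm cp θ
  exact ⟨by unfold pPlus; linarith, by unfold pPlus; linarith⟩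

/-- The right point is closer to `θs`. The one delicate case is an overshoot `θs < cp θ`, where `d
(cp θ) θs < Δ / 2 < d (cm θ) θs` by comparison with `θ`. -/
lemma half_lt_pPlus {d : ℝ → ℝ → ℝ} {θs γ bΘ Δ : ℝ} {cm cp : ℝ → ℝ} (hd : IsLineDistance d)
    (hΔ : 0 < Δ) (hγ : 0 < γ) (hc : IsComparisonPair d bΘ Δ cm cp) {θ : ℝ}
    (hθ : θ ∈ Set.Icc (-bΘ) bΘ) (h : θ < θs) : 1 / 2 < pPlus d θs γ cm cp θ := by
  obtain ⟨h1, h2, h3, h4⟩ := hc θ hθ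
  have key : d (cp θ) θs < d (cm θ) θs := by
    rcases lt_trichotomy (cp θ) θs with h5 | h5 | h5
    · exact hd.lt_right _ _ _ (h1.trans h2) h5
    · have := hd.lt_left _ _ _ h1 h
      rw [h5, hd.self]
      linarith
    · have h6 := hd.lt_right _ _ _ h h5
      have h7 := hd.lt_left _ _ _ h1 h
      rw [hd.symm (cp θ) θs]
      rw [hd.symm (cp θ) θ] at h4
      linarith
  have he : 1 < Real.exp ((utility d θs (cp θ) - utility d θs (cm θ)) / γ) := by
    rw [Real.one_lt_exp_iff]
    exact div_pos (by unfold utility; linarith) hγ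
  have : pMinus d θs γ cm cp θ < 1 / 2 := by
    unfold pMinus
    rw [one_div]
    exact inv_strictAnti₀ (by norm_num) (by linarith)
  unfold pPlus
  linarith

lemma pPlus_lt_half {d : ℝ → ℝ → ℝ} {θs γ bΘ Δ : ℝ} {cm cp : ℝ → ℝ} (hd : IsLineDistance d)
    (hΔ : 0 < Δ) (hγ : 0 < γ) (hc : IsComparisonPair d bΘ Δ cm cp) {θ : ℝ}
    (hθ : θ ∈ Set.Icc (-bΘ) bΘ) (h : θs < θ) : pPlus d θs γ cm cp θ < 1 / 2 := by
  obtain ⟨h1, h2, h3, h4⟩ := hc θ hθ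
  have key : d (cm θ) θs < d (cp θ) θs := by
    rw [hd.symm (cm θ), hd.symm (cp θ)]
    rcases lt_trichotomy (cm θ) θs with h5 | h5 | h5
    · have h6 := hd.lt_left _ _ _ h5 h
      have h7 := hd.lt_right _ _ _ h h2
      rw [hd.symm θs (cm θ)]
      rw [hd.symm (cp θ) θ] at h4
      linarith
    · have := hd.lt_right _ _ _ h h2
      rw [h5, hd.self]
      rw [hd.symm (cp θ) θ] at h4
      linarith
    · exact hd.lt_left _ _ _ h5 (h1.trans h2)
  have he : Real.exp ((utility d θs (cp θ) - utility d θs (cm θ)) / γ) < 1 := by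
    rw [Real.exp_lt_one_iff]
    exact div_neg_of_neg_of_pos (by unfold utility; linarith) hγ
  have : 1 / 2 < pMinus d θs γ cm cp θ := by
    unfold pMinus
    rw [one_div]
    exact inv_strictAnti₀ (by positivity) (by linarith)
  unfold pPlus
  linarith

lemma phi_pTilde (c₁ c₂ : ℝ) (d : ℝ → ℝ → ℝ) (θs γ : ℝ) (cm cp : ℝ → ℝ) (θ : ℝ) :
    phi c₁ c₂ (pTilde d θs γ cm cp θ) = phi c₁ c₂ (pPlus d θs γ cm cp θ) := by
  unfold pTilde
  split_ifs
  · rfl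
  · have : |2 * pMinus d θs γ cm cp θ - 1| = |2 * pPlus d θs γ cm cp θ - 1| := by
      rw [← abs_neg, pPlus]
      ring_nf
    rw [phi, phi, this]

/-! ### The comparisons of Phase I -/

open Classical in
/-- The number of comparisons at query points in `A` when there is no early stopping. -/
noncomputable def regionComparisons (p η : ℝ) (pr ρ₀ : ℝ → ℝ) (A : Set ℝ) (u : ℕ → ℕ → ℝ) :
    ENNReal :=
  ∑' k, if query p η pr ρ₀ u k ∈ A then (testLength p η pr ρ₀ u k : ENNReal) else 0

lemma measurable_regionComparisons (p η : ℝ) (pr ρ₀ : ℝ → ℝ) (A : Set ℝ) :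
    Measurable (regionComparisons p η pr ρ₀ A) := by
  classical
  refine Measurable.tsum fun k => ?_
  refine measurable_comp_posterior p η pr (Q := fun ρ v => if median ρ ∈ A then
    ((testTime η fun i => response (v i) (pr (median ρ)) : ℕ∞) : ENNReal) else 0)
    (fun ρ => ?_) k ρ₀
  split_ifs
  · exact (measurable_of_countable fun t : ℕ∞ => (t : ENNReal)).comp
      ((measurable_testTime η).comp (measurable_responses _))
  · exact measurable_const

lemma comparisons_le (p η : ℝ) (pr ρ₀ : ℝ → ℝ) (kLoc kEnd sMax : ℕ∞) (u : ℕ → ℕ → ℝ) (k : ℕ) :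
    comparisons p η pr ρ₀ kLoc kEnd sMax u k ≤ testLength p η pr ρ₀ u k := by
  unfold comparisons
  split_ifs
  · exact min_le_left _ _
  · exact le_rfl
  · exact zero_le

/-- The cut-off at `psi` and the early stopping are simply dropped; a query point at distance at
least `a` from `θs` lies in one of the two far regions. -/
lemma phaseOneComparisons_le (p η : ℝ) (pr ρ₀ : ℝ → ℝ) (kLoc kEnd sMax : ℕ∞) (bΘ θs a : ℝ)
    (u : ℕ → ℕ → ℝ) :
    phaseOneComparisons p η pr ρ₀ kLoc kEnd sMax bΘ θs a u ≤
      regionComparisons p η pr ρ₀ (Set.Iic (θs - a)) u +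
        regionComparisons p η pr ρ₀ (Set.Ici (θs + a)) u := by
  classical
  unfold phaseOneComparisons regionComparisons
  rw [← ENNReal.tsum_add]
  refine ENNReal.tsum_le_tsum fun k => ?_
  have hle : ((comparisons p η pr ρ₀ kLoc kEnd sMax u k : ℕ∞) : ENNReal) ≤
      (testLength p η pr ρ₀ u k : ENNReal) :=
    ENat.toENNReal_le.2 (comparisons_le p η pr ρ₀ kLoc kEnd sMax u k)
  split_ifs with h h1 h2 h3 h4 h5
  · exact hle.trans le_self_add
  · rwa [add_zero]
  · rwa [zero_add]
  · rcases le_abs.1 h.2 with h6 | h6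
    · exact absurd (show θs + a ≤ _ by linarith) h3
    · exact absurd (show _ ≤ θs - a by linarith) h1
  all_goals exact zero_le

lemma query_mem_Icc {p η b : ℝ} (hη₀ : 0 < η) (hη₁ : η < 1) (hp : p ∈ Set.Icc (0 : ℝ) 1)
    {pr ρ₀ : ℝ → ℝ} (hρ : IsDensityOn b ρ₀) (u : ℕ → ℕ → ℝ) (k : ℕ) :
    query p η pr ρ₀ u k ∈ Set.Icc (-b) b := by
  have h : IsDensityOn b (posterior p η pr ρ₀ u k) := by
    induction k with
    | zero => exact hρ
    | succ k ih =>
      obtain ⟨s, hs, hst⟩ := stage_eq_or p hη₀ hη₁ pr (posterior p η pr ρ₀ u k) (u k)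
      change IsDensityOn b (stage p η pr (posterior p η pr ρ₀ u k) (u k))
      rw [hst]
      exact ih.update_median hp hs
  exact h.median_spec.1

lemma map_eq_arrayLaw {Ω : Type*} [MeasurableSpace Ω] {P : Measure Ω}
    {U : ℕ → ℕ → Ω → ℝ} (hU : ∀ k i, Measurable (U k i))
    (hlaw : ∀ k i, P.map (U k i) = unif)
    (hind : iIndepFun (fun j : ℕ × ℕ => U j.1 j.2) P) :
    P.map (fun ω k i => U k i ω) = arrayLaw := by
  have h := hind.map_fun_eq_infinitePi_map fun j : ℕ × ℕ => hU j.1 j.2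
  simp_rw [hlaw] at h
  have hc := Measure.infinitePi_map_curry (fun _ _ : ℕ => unif)
  rw [← h, Measure.map_map (MeasurableEquiv.measurable _)
    (measurable_pi_iff.2 fun j : ℕ × ℕ => hU j.1 j.2)] at hc
  exact hc

/-- The prior enters only through the initial odds, which are at most `1 / m`. -/
lemma lintegral_region_le {η p θs b m : ℝ} {s : ℤ} {A N : Set ℝ} {ρ pr : ℝ → ℝ} (hη₀ : 0 < η)
    (hη₁ : η < 1) (hp : 1 / 2 < p) (hp' : p < 1 - η / 2) (hAN : IsFarNear θs s A N)
    (hρ : IsDensityOn b ρ) (hm : 0 < m) (hN : ENNReal.ofReal m ≤ densityMeasure ρ N)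
    (hpr : ∀ x ∈ Set.Icc (-b) b, θs ∉ gainSide (-s) x → θs ≠ x → Informative s (pr x))
    {K : ENNReal}
    (hK : ∀ x ∈ Set.Icc (-b) b, x ∈ A → ∫⁻ z, (testTime η z : ENNReal) ∂coins (pr x) ≤ K) :
    ∫⁻ u, regionComparisons p η pr ρ A u ∂arrayLaw ≤
      K * ENNReal.ofReal ((sqrtDrift η p)⁻¹ * √(1 / m)) := by
  have := hρ.isProbabilityMeasure
  have hκ := sqrtDrift_pos hη₀ hp hp'
  have hmN : m ≤ mass ρ N := (ENNReal.ofReal_le_iff_le_toReal (measure_ne_top _ _)).1 hN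
  refine (lintegral_far_le hη₀ hη₁ hp hp' hAN hρ (hm.trans_le hmN) hpr hK).trans ?_
  have hA1 := hρ.mass_add_le_one hAN.measurable_near hAN.disjoint
  have h1 : odds A N ρ ≤ 1 / m := by
    unfold odds
    have := mass_nonneg ρ N
    gcongr
    linarith
  gcongr

end MAPB

/-! ### The sample complexity of Phase I -/

theorem mainTheorem9 (η : ℝ) (hη₀ : 0 < η) (hη₁ : η < 1) :
    ∃ c₁ c₂ : ℝ, 0 < c₁ ∧ 0 < c₂ ∧
    ∀ p : ℝ, 1 / 2 < p → p < 1 - η / 2 →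
    ∃ r₁ r₂ α β₂ rR : ℝ, 0 < r₁ ∧ 0 < r₂ ∧ 0 < α ∧ 0 < β₂ ∧ 0 < rR ∧
    ∀ θs : ℝ, 0 < θs →
    ∃ β₁ : ℝ, 0 < β₁ ∧
    ∀ bΘ : ℝ, θs ≤ bΘ →
    ∀ ρ₀ : ℝ → ℝ, MAPB.IsPriorDensity bΘ ρ₀ →
    ∀ a ς : ℝ, 0 < a → a < θs + bΘ → ς ≤ 1 →
    ENNReal.ofReal (a ^ ς) ≤ MAPB.densityMeasure ρ₀ (Set.Ioc (θs - a) θs) →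
    (θs + a ≤ bΘ →
      ENNReal.ofReal (a ^ ς) ≤ MAPB.densityMeasure ρ₀ (Set.Ico θs (θs + a))) →
    ∀ (d : ℝ → ℝ → ℝ) (Δ γ : ℝ) (cm cp : ℝ → ℝ),
    MAPB.IsLineDistance d → 0 < Δ → 0 < γ → MAPB.IsComparisonPair d bΘ Δ cm cp →
    ∀ kLoc kEnd sMax : ℕ∞,
    ∀ (Ω : Type*) [MeasurableSpace Ω] (P : Measure Ω) [IsProbabilityMeasure P]
      (U : ℕ → ℕ → Ω → ℝ),
    (∀ k i, Measurable (U k i)) →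
    (∀ k i, P.map (U k i) = volume.restrict (Set.Icc (0 : ℝ) 1)) →
    iIndepFun (fun j : ℕ × ℕ => U j.1 j.2) P →
    ∫⁻ ω, MAPB.phaseOneComparisons p η (MAPB.pPlus d θs γ cm cp) ρ₀ kLoc kEnd sMax bΘ θs a
        (fun k i => U k i ω) ∂P
      ≤ ENNReal.ofReal (4 * θs / (r₂ * α * a ^ ς) + 4 * β₁ / r₁ + 2 * β₂ / rR) *
        ⨆ θ ∈ {θ : ℝ | θ ∈ Set.Icc (-bΘ) bΘ ∧ a ≤ |θ - θs|},
          ENNReal.ofReal (MAPB.phi c₁ c₂ (MAPB.pTilde d θs γ cm cp θ)) := by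
  have hL := MAPB.lengthConst_pos hη₀ hη₁
  refine ⟨128 + 2 * MAPB.lengthConst η, 4 * MAPB.lengthConst η, by linarith, by linarith,
    fun p hp hp' => ?_⟩
  have hκ := MAPB.sqrtDrift_pos hη₀ hp hp'
  set κ := MAPB.sqrtDrift η p
  -- With these choices and the `β₁` below, the factor in the claim becomes `2θs / (κ a ^ ς) + 1 /
  -- (2κθs) + 2`; the last summand is spare.
  refine ⟨1, 1, 2 * κ, 1, 1, one_pos, one_pos, by linarith, one_pos, one_pos, fun θs hθs => ?_⟩
  refine ⟨1 / (8 * κ * θs), by positivity, ?_⟩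
  intro bΘ hb ρ₀ hρ₀ a ς ha haΘ _ hleft hright d Δ γ cm cp hd hΔ hγ hc kLoc kEnd sMax Ω _ P _ U
    hU hlaw hind
  have hρ : MAPB.IsDensityOn bΘ ρ₀ := ⟨hρ₀.measurable, hρ₀.eq_zero, hρ₀.mass_one⟩
  have hm : 0 < a ^ ς := Real.rpow_pos_of_pos ha ς
  set K : ENNReal := ⨆ θ ∈ {θ : ℝ | θ ∈ Set.Icc (-bΘ) bΘ ∧ a ≤ |θ - θs|},
    ENNReal.ofReal (MAPB.phi (128 + 2 * MAPB.lengthConst η) (4 * MAPB.lengthConst η)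
      (MAPB.pTilde d θs γ cm cp θ))
  set pr := MAPB.pPlus d θs γ cm cp
  have hpr1 : ∀ x ∈ Set.Icc (-bΘ) bΘ, x < θs → MAPB.Informative 1 (pr x) := fun x hx h => by
    have h1 := MAPB.half_lt_pPlus hd hΔ hγ hc hx h
    exact ⟨MAPB.pPlus_mem_Ioo _ _ _ _ _ _, h1.ne', fun _ => h1.le, fun h => by norm_num at h⟩
  have hpr2 : ∀ x ∈ Set.Icc (-bΘ) bΘ, θs < x → MAPB.Informative (-1) (pr x) := fun x hx h => by
    have h1 := MAPB.pPlus_lt_half hd hΔ hγ hc hx h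
    exact ⟨MAPB.pPlus_mem_Ioo _ _ _ _ _ _, h1.ne, fun h => by norm_num at h, fun _ => h1.le⟩
  have hK : ∀ x ∈ Set.Icc (-bΘ) bΘ, a ≤ |x - θs| →
      ∫⁻ z, (MAPB.testTime η z : ENNReal) ∂MAPB.coins (pr x) ≤ K := by
    intro x hx hxa
    have hne : x ≠ θs := by
      rintro rfl
      rw [sub_self, abs_zero] at hxa
      linarith
    have hhalf : pr x ≠ 1 / 2 := by
      rcases lt_or_gt_of_ne hne with h | h
      · exact (hpr1 x hx h).2.1
      · exact (hpr2 x hx h).2.1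
    refine (MAPB.lintegral_testTime_le_phi hη₀ hη₁ (MAPB.pPlus_mem_Ioo _ _ _ _ _ _) hhalf).trans ?_
    rw [← MAPB.phi_pTilde]
    exact le_iSup₂ (f := fun θ (_ : θ ∈ {θ : ℝ | θ ∈ Set.Icc (-bΘ) bΘ ∧ a ≤ |θ - θs|}) =>
      ENNReal.ofReal (MAPB.phi (128 + 2 * MAPB.lengthConst η) (4 * MAPB.lengthConst η)
        (MAPB.pTilde d θs γ cm cp θ))) x ⟨hx, hxa⟩
  have hL1 : ∫⁻ u, MAPB.regionComparisons p η pr ρ₀ (Set.Iic (θs - a)) u ∂MAPB.arrayLaw ≤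
      K * ENNReal.ofReal (κ⁻¹ * √(1 / a ^ ς)) := by
    refine MAPB.lintegral_region_le hη₀ hη₁ hp hp' (MAPB.isFarNear_left ha) hρ hm hleft ?_ ?_
    · intro x hx h1 h2
      have h3 : x ≤ θs := by simpa [MAPB.gainSide] using h1
      exact hpr1 x hx (lt_of_le_of_ne h3 h2.symm)
    · intro x hx hxA
      have : x ≤ θs - a := hxA
      exact hK x hx (le_abs.2 (Or.inr (by linarith)))
  have hR1 : ∫⁻ u, MAPB.regionComparisons p η pr ρ₀ (Set.Ici (θs + a)) u ∂MAPB.arrayLaw ≤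
      K * ENNReal.ofReal (κ⁻¹ * √(1 / a ^ ς)) := by
    rcases le_or_gt (θs + a) bΘ with hle | hgt
    · refine MAPB.lintegral_region_le hη₀ hη₁ hp hp' (MAPB.isFarNear_right ha) hρ hm
        (hright hle) ?_ ?_
      · intro x hx h1 _
        have h3 : θs < x := by simpa [MAPB.gainSide] using h1
        exact hpr2 x hx h3
      · intro x hx hxA
        have : θs + a ≤ x := hxA
        exact hK x hx (le_abs.2 (Or.inl (by linarith)))
    -- The prior mass near `θs` on the right is not controlled here, but the far region lies outside
    -- the parameter interval and is never queried.
    · have h0 : ∀ u, MAPB.regionComparisons p η pr ρ₀ (Set.Ici (θs + a)) u = 0 := by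
        intro u
        refine ENNReal.tsum_eq_zero.2 fun k => if_neg fun h => ?_
        have h1 := (MAPB.query_mem_Icc (p := p) (pr := pr) hη₀ hη₁ ⟨by linarith, by linarith⟩ hρ u k).2
        exact absurd (hgt.trans_le h) (not_lt.2 h1)
      simp [h0]
  have hUm : Measurable fun ω (k i : ℕ) => U k i ω :=
    measurable_pi_iff.2 fun k => measurable_pi_iff.2 fun i => hU k i
  calc ∫⁻ ω, MAPB.phaseOneComparisons p η pr ρ₀ kLoc kEnd sMax bΘ θs a (fun k i => U k i ω) ∂P
      ≤ ∫⁻ ω, MAPB.regionComparisons p η pr ρ₀ (Set.Iic (θs - a)) (fun k i => U k i ω) +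
          MAPB.regionComparisons p η pr ρ₀ (Set.Ici (θs + a)) (fun k i => U k i ω) ∂P :=
        lintegral_mono fun ω => MAPB.phaseOneComparisons_le _ _ _ _ _ _ _ _ _ _ _
    _ = (∫⁻ u, MAPB.regionComparisons p η pr ρ₀ (Set.Iic (θs - a)) u ∂MAPB.arrayLaw) +
          ∫⁻ u, MAPB.regionComparisons p η pr ρ₀ (Set.Ici (θs + a)) u ∂MAPB.arrayLaw := by
        have hm1 := MAPB.measurable_regionComparisons p η pr ρ₀ (Set.Iic (θs - a))
        have hm2 := MAPB.measurable_regionComparisons p η pr ρ₀ (Set.Ici (θs + a))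
        rw [← MAPB.map_eq_arrayLaw hU hlaw hind, lintegral_map hm1 hUm, lintegral_map hm2 hUm,
          lintegral_add_left (by exact hm1.comp hUm)]
    _ ≤ K * ENNReal.ofReal (κ⁻¹ * √(1 / a ^ ς)) + K * ENNReal.ofReal (κ⁻¹ * √(1 / a ^ ς)) :=
        add_le_add hL1 hR1
    _ = ENNReal.ofReal (2 * (κ⁻¹ * √(1 / a ^ ς))) * K := by
        rw [← mul_add, ← ENNReal.ofReal_add (by positivity) (by positivity), ← two_mul, mul_comm]
    _ ≤ _ := by
        gcongr
        have hy := Real.sq_sqrt (show 0 ≤ 1 / a ^ ς by positivity)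
        set y := √(1 / a ^ ς)
        have e : 4 * θs / (1 * (2 * κ) * a ^ ς) + 4 * (1 / (8 * κ * θs)) / 1 + 2 * 1 / 1 -
            2 * (κ⁻¹ * y) = κ⁻¹ * (2 * θs * (1 / a ^ ς) + 1 / (2 * θs) - 2 * y) + 2 := by
          field_simp
          ring
        -- The two sides together contribute `2 * κ⁻¹ * y`, and this square is the inequality `2y ≤
        -- 2θs y² + 1 / (2θs)`, with `y² = 1 / a ^ ς`.
        have e2 : 2 * θs * y ^ 2 + 1 / (2 * θs) - 2 * y = (2 * θs * y - 1) ^ 2 / (2 * θs) := by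
          field_simp
          ring
        rw [← hy, e2] at e
        have : 0 ≤ κ⁻¹ * ((2 * θs * y - 1) ^ 2 / (2 * θs)) + 2 := by positivity
        linarith
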